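/- Let ${}_2F_1(a,b;c;\cdot)$ denote the principal branch of the Gauss hypergeometric function, i.e. the holomorphic function on $\mathbb{C}\setminus[1,\infty)$ that equals $\sum_{k\ge 0}\frac{(a)_k(b)_k}{(c)_k\,k!}z^k$ for $|z|<1$ (part of the claim is that it exists for the parameters below). Let $(a)_k=a(a+1)\cdots(a+k-1)$, let $\psi=\Gamma'/\Gamma$, let $\log$ and $\arg$ be principal, and read $1/\Gamma$ as $0$ at $0,-1,-2,\dots$. (i) Let $\mu,\nu,\rho\in\mathbb{C}$ satisfy $\rho-\nu\in\mathbb{Z}^+$, $\mathrm{Re}(\nu)>0$, $\mathrm{Re}(\rho)>0$, $\rho\notin\mathbb{Z}$ and $\mathrm{Re}(\rho-\nu+\mu)>0$. Then for all $z\neq 0$ with $|z|<1$ and $|\arg z|<\pi$, the infinite series below converges absolutely and $$ \begin{aligned} {}_2F_1(\mu,\nu;\mu+\rho;1-z)={}&(-1)^{\nu-\rho+1}\frac{\Gamma(\mu+\rho)}{\Gamma(\mu)\Gamma(\nu)\Gamma(\rho-\nu+1)}\,z^{\rho-\nu}\sum_{k=0}^{\infty}\frac{(\rho)_k(\mu+\rho-\nu)_k}{(\rho-\nu+1)_k\,k!}\\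 &\quad\times\bigl[\log z-\psi(k+\rho-\nu+1)+\psi(k+\rho-\nu+\mu)+\psi(k+\rho)-\psi(k+1)\bigr]z^k\\ &+\frac{\Gamma(\mu+\rho)}{\Gamma(\rho)\Gamma(\mu+\rho-\nu)}\sum_{k=0}^{\rho-\nu-1}(-1)^k\frac{(\mu)_k(\nu)_k(\rho-\nu-k-1)!}{k!}z^k . \end{aligned} $$ (ii) Let $m\in\mathbb{Z}^+$ and let $\mu,\nu\in\mathbb{C}$ be such that none of $\mu+m$, $\nu+m$, $\mu+\nu+m$ is a nonpositive integer (for the first two this holds in particular when $\mathrm{Re}(\mu)>-m$ and $\mathrm{Re}(\nu)>-m$). Then for all $z\ne 1$ with $|1-z|<1$ and $|\arg(1-z)|<\pi$, the infinite series below converges absolutely and $$ \begin{aligned} {}_2F_1(\mu,\nu;\mu+\nu+m;z)={}&\frac{\Gamma(\mu+\nu+m)}{\Gamma(\mu+m)\Gamma(\nu+m)}\sum_{k=0}^{m-1}\frac{(\mu)_k(\nu)_k(m-k-1)!}{k!}(z-1)^k\\ &-(z-1)^m\frac{\Gamma(\mu+\nu+m)}{\Gamma(\nu)\Gamma(\mu)\,m!}\sum_{k=0}^{\infty}\frac{(\nu+m)_k(\mu+m)_k}{(m+1)_k\,k!}(1-z)^k\\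 &\quad\times\bigl[\log(1-z)-\psi(k+m+1)+\psi(k+\mu+m)+\psi(k+\nu+m)-\psi(k+1)\bigr]. \end{aligned} $$ -/

import Mathlib

/-- The Pochhammer symbol `(a)_k = a (a + 1) ⋯ (a + k - 1)`. -/
noncomputable def poch (a : ℂ) (k : ℕ) : ℂ := (ascPochhammer ℂ k).eval a

/-- The complex plane cut along `[1, ∞)`. -/
def cutPlane : Set ℂ := {z : ℂ | 1 - z ∈ Complex.slitPlane}

/-- `F` is the principal branch of the Gauss function with parameters `a, b; c`: it is holomorphic
on the plane cut along `[1, ∞)` and is the sum of the hypergeometric power series on the open unit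
disc. The cut plane is connected, so the values of such an `F` on it are unique. -/
def IsGaussPrincipalBranch (a b c : ℂ) (F : ℂ → ℂ) : Prop :=
  DifferentiableOn ℂ F cutPlane ∧ ∀ z : ℂ, ‖z‖ < 1 → F z = ordinaryHypergeometric a b c z

open Classical in
/-- The principal branch of the Gauss hypergeometric function `₂F₁(a, b; c; z)`, by analytic
continuation of its power series to the plane cut along `[1, ∞)`. -/
noncomputable def gaussF (a b c : ℂ) : ℂ → ℂ :=
  if h : ∃ F : ℂ → ℂ, IsGaussPrincipalBranch a b c F then h.choose else fun _ => 0

/-! Put `w = 1 - z`. Both parts are readings of one identity, Γ(a+m)Γ(b+m)/Γ(a+b+m) · F(1-w) = P(w)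
+ log w · Q(w), where F is the branch with parameters a, b; a+b+m and P, Q have coefficients
`regCoeff a b m`, `logCoeff a b m`. `HasLogExpansion` bundles it with the existence of F. It is
proved for m = 0 and large real parts, then carried to all parameters.

Base case (`eulerIntegral_eq_expansion`): if m = 0 and Re a, Re b ≥ 2, Euler's integral continues
the series to the cut plane. Near w = 0 the integral and the expansion satisfy the same
hypergeometric equation, whose solutions regular at 0 are multiples of φ = ₂F₁(a,b;1;w) and whose
other solutions grow like log w. Hence a solution tending to 0 as w → 0+ vanishes
(`eventually_eq_zero_of_ode`, by the Wronskian with φ). The difference of the two sides is such a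
solution, because both sides plus log w tend to 2ψ(1) - ψ(a) - ψ(b); for the integral this rests on
Gauss's formula ∫ (t^(b-1) - 1)/(1-t) dt = ψ(1) - ψ(b). The identity theorem then reaches the whole
slit disc.

Transport: operators z(1-z) d/dz + (c - ez) send the function with parameters a+1, b; c+1 (e = b) or
a+1, b+1; c+1 (e = a+b+1) to c times the one with a, b; c. The first lowers a at m = 0, the second
raises m by one. They preserve holomorphy on the cut plane and act on P + log w · Q by explicit
recurrences (`HasLogExpansion.left`, `HasLogExpansion.both`), so induction covers every admissible
a, b, m (`hasLogExpansion_of_base`). -/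

/-- A sequence of polynomial growth. -/
def PolyGrowth (u : ℕ → ℂ) : Prop :=
  ∃ (C : ℝ) (K : ℕ), 0 ≤ C ∧ ∀ n, ‖u n‖ ≤ C * ((n : ℝ) + 1) ^ K

/-- The sum of the power series with coefficients `u`. -/
noncomputable def powerSum (u : ℕ → ℂ) (z : ℂ) : ℂ := ∑' n, u n * z ^ n

/-- The coefficients of the derivative of a power series. -/
def derivCoeff (u : ℕ → ℂ) (n : ℕ) : ℂ := (n + 1) * u (n + 1)

/-! ### Power series with coefficients of polynomial growth -/

namespace PolyGrowth

theorem const (c : ℂ) : PolyGrowth fun _ => c :=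
  ⟨‖c‖, 0, norm_nonneg _, by simp⟩

theorem natCast : PolyGrowth fun n => (n : ℂ) :=
  ⟨1, 1, zero_le_one, fun n => by simp⟩

theorem add {u v : ℕ → ℂ} (hu : PolyGrowth u) (hv : PolyGrowth v) :
    PolyGrowth fun n => u n + v n := by
  obtain ⟨C, K, hC, h⟩ := hu
  obtain ⟨D, L, hD, g⟩ := hv
  refine ⟨C + D, K + L, by positivity, fun n => ?_⟩
  have h1 : (1 : ℝ) ≤ (n : ℝ) + 1 := by linarith [n.cast_nonneg (α := ℝ)]
  have e1 : ((n : ℝ) + 1) ^ K ≤ ((n : ℝ) + 1) ^ (K + L) := pow_le_pow_right₀ h1 (by omega)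
  have e2 : ((n : ℝ) + 1) ^ L ≤ ((n : ℝ) + 1) ^ (K + L) := pow_le_pow_right₀ h1 (by omega)
  calc ‖u n + v n‖ ≤ ‖u n‖ + ‖v n‖ := norm_add_le _ _
    _ ≤ C * ((n : ℝ) + 1) ^ K + D * ((n : ℝ) + 1) ^ L := add_le_add (h n) (g n)
    _ ≤ C * ((n : ℝ) + 1) ^ (K + L) + D * ((n : ℝ) + 1) ^ (K + L) := by gcongr
    _ = _ := by ring

theorem mul {u v : ℕ → ℂ} (hu : PolyGrowth u) (hv : PolyGrowth v) :
    PolyGrowth fun n => u n * v n := by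
  obtain ⟨C, K, hC, h⟩ := hu
  obtain ⟨D, L, hD, g⟩ := hv
  refine ⟨C * D, K + L, by positivity, fun n => ?_⟩
  calc ‖u n * v n‖ = ‖u n‖ * ‖v n‖ := norm_mul _ _
    _ ≤ (C * ((n : ℝ) + 1) ^ K) * (D * ((n : ℝ) + 1) ^ L) :=
        mul_le_mul (h n) (g n) (norm_nonneg _) (by positivity)
    _ = _ := by ring

theorem const_mul {u : ℕ → ℂ} (c : ℂ) (hu : PolyGrowth u) : PolyGrowth fun n => c * u n :=
  (const c).mul hu

theorem neg {u : ℕ → ℂ} (hu : PolyGrowth u) : PolyGrowth fun n => -u n := by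
  simpa using hu.const_mul (-1)

theorem sub {u v : ℕ → ℂ} (hu : PolyGrowth u) (hv : PolyGrowth v) :
    PolyGrowth fun n => u n - v n := by
  simpa [sub_eq_add_neg] using hu.add hv.neg

theorem succ {u : ℕ → ℂ} (hu : PolyGrowth u) : PolyGrowth fun n => u (n + 1) := by
  obtain ⟨C, K, hC, h⟩ := hu
  refine ⟨C * 2 ^ K, K, by positivity, fun n => (h (n + 1)).trans ?_⟩
  rw [mul_assoc, ← mul_pow]
  gcongr
  push_cast
  linarith [n.cast_nonneg (α := ℝ)]

theorem shift {u : ℕ → ℂ} (hu : PolyGrowth u) (m : ℕ) : PolyGrowth fun n => u (n + m) := by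
  induction m with
  | zero => simpa using hu
  | succ m ih => simpa [add_assoc, add_comm, add_left_comm] using ih.succ

theorem of_succ {u : ℕ → ℂ} (hu : PolyGrowth fun n => u (n + 1)) : PolyGrowth u := by
  obtain ⟨C, K, hC, h⟩ := hu
  refine ⟨C + ‖u 0‖, K, by positivity, fun n => ?_⟩
  rcases n with _ | n
  · simpa using hC
  · refine (h n).trans ?_
    have : C ≤ C + ‖u 0‖ := by linarith [norm_nonneg (u 0)]
    gcongr
    simp

theorem of_add {u : ℕ → ℂ} (m : ℕ) (hu : PolyGrowth fun n => u (n + m)) : PolyGrowth u := by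
  induction m generalizing u with
  | zero => simpa using hu
  | succ m ih =>
    refine of_succ (ih ?_)
    simpa [add_assoc, add_comm, add_left_comm] using hu

theorem derivCoeff {u : ℕ → ℂ} (hu : PolyGrowth u) : PolyGrowth (derivCoeff u) :=
  (natCast.add (const 1)).mul hu.succ

/-- By Bernoulli each ratio is at most ((n+2)/(n+1))^K, and these bounds telescope. -/
theorem of_ratio {u : ℕ → ℂ} (K : ℕ)
    (h : ∀ n, ‖u (n + 1)‖ ≤ ‖u n‖ * (1 + K / ((n : ℝ) + 1))) : PolyGrowth u := by
  refine ⟨‖u 0‖, K, norm_nonneg _, fun n => ?_⟩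
  induction n with
  | zero => simp
  | succ n ih =>
    have hn : (0 : ℝ) < (n : ℝ) + 1 := by positivity
    have hB : 1 + (K : ℝ) * (1 / ((n : ℝ) + 1)) ≤ (1 + 1 / ((n : ℝ) + 1)) ^ K :=
      one_add_mul_le_pow (by have : 0 < 1 / ((n : ℝ) + 1) := by positivity
                             linarith) K
    calc ‖u (n + 1)‖ ≤ ‖u n‖ * (1 + K / ((n : ℝ) + 1)) := h n
      _ ≤ (‖u 0‖ * ((n : ℝ) + 1) ^ K) * (1 + 1 / ((n : ℝ) + 1)) ^ K := by
          refine mul_le_mul ih (by rwa [mul_one_div] at hB) (by positivity) (by positivity)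
      _ = ‖u 0‖ * (((n : ℝ) + 1) * (1 + 1 / ((n : ℝ) + 1))) ^ K := by rw [mul_pow]; ring
      _ = _ := by
          congr 2
          push_cast
          field_simp

theorem of_recurrence {u : ℕ → ℂ} (x : ℂ) (h : ∀ n, u (n + 1) * (n + 1) = u n * (x + n)) :
    PolyGrowth u := by
  obtain ⟨K, hK⟩ := exists_nat_ge ‖x‖
  refine of_ratio K fun n => ?_
  have hn : ((n : ℂ) + 1) ≠ 0 := by exact_mod_cast n.succ_ne_zero
  have hn' : (0 : ℝ) < (n : ℝ) + 1 := by positivity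
  have e : u (n + 1) = u n * ((x + n) / (n + 1)) := by
    rw [← mul_div_assoc, ← h, mul_div_cancel_right₀ _ hn]
  have en : ‖(n : ℂ) + 1‖ = (n : ℝ) + 1 := by
    rw [show (n : ℂ) + 1 = ((n + 1 : ℕ) : ℂ) by push_cast; ring, Complex.norm_natCast]
    push_cast; ring
  rw [e, norm_mul, norm_div, en]
  gcongr
  rw [div_le_iff₀ hn', add_mul, div_mul_cancel₀ _ hn'.ne']
  calc ‖x + n‖ ≤ ‖x‖ + ‖(n : ℂ)‖ := norm_add_le _ _
    _ = ‖x‖ + n := by rw [Complex.norm_natCast]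
    _ ≤ _ := by linarith

/-- Only indices beyond ‖c‖ + 1 matter, and there `c + n` stays away from 0. No condition on `c` is
needed: if some `c + n` is 0, division by zero makes the sequence vanish from there on. -/
theorem of_inv_recurrence {u : ℕ → ℂ} (c : ℂ) (h : ∀ n, u (n + 1) = u n * ((n + 1) / (c + n))) :
    PolyGrowth u := by
  obtain ⟨N, hN⟩ := exists_nat_ge (‖c‖ + 1)
  obtain ⟨K, hK⟩ := exists_nat_ge (‖c‖ + 1)
  refine of_add N (of_ratio K fun n => ?_)
  have hn' : (0 : ℝ) < (n : ℝ) + 1 := by positivity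
  have en : ‖((n + N : ℕ) : ℂ) + 1‖ = (n : ℝ) + N + 1 := by
    rw [show ((n + N : ℕ) : ℂ) + 1 = ((n + N + 1 : ℕ) : ℂ) by push_cast; ring, Complex.norm_natCast]
    push_cast; ring
  have hl : (n : ℝ) + N - ‖c‖ ≤ ‖c + (n + N : ℕ)‖ := by
    have := norm_sub_le (c + (n + N : ℕ)) c
    rw [add_sub_cancel_left, Complex.norm_natCast] at this
    push_cast at this ⊢
    linarith
  have hpos : (0 : ℝ) < (n : ℝ) + N - ‖c‖ := by linarith
  rw [show n + 1 + N = n + N + 1 by ring, h (n + N), norm_mul, norm_div, en]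
  gcongr
  calc ((n : ℝ) + N + 1) / ‖c + (n + N : ℕ)‖ ≤ ((n : ℝ) + N + 1) / ((n : ℝ) + N - ‖c‖) := by gcongr
    _ = 1 + (‖c‖ + 1) / ((n : ℝ) + N - ‖c‖) := by field_simp; ring
    _ ≤ 1 + K / ((n : ℝ) + 1) := by gcongr; linarith

/-- The increments eventually have norm at most 1, so growth is at most linear. For the digamma
function this crude bound suffices, without asymptotics. -/
theorem of_increment {u : ℕ → ℂ} (x : ℂ) (h : ∀ n, u (n + 1) = u n + (x + n)⁻¹) :
    PolyGrowth u := by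
  obtain ⟨N, hN⟩ := exists_nat_ge (‖x‖ + 1)
  refine of_add N ⟨‖u N‖ + 1, 1, by positivity, fun n => ?_⟩
  have key : ‖u (n + N)‖ ≤ ‖u N‖ + n := by
    induction n with
    | zero => simp
    | succ n ih =>
      have hl : 1 ≤ ‖x + (n + N : ℕ)‖ := by
        have := norm_sub_le (x + (n + N : ℕ)) x
        rw [add_sub_cancel_left, Complex.norm_natCast] at this
        push_cast at this ⊢
        linarith [n.cast_nonneg (α := ℝ)]
      rw [show n + 1 + N = n + N + 1 by ring, h (n + N)]
      refine (norm_add_le _ _).trans ?_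
      have : ‖(x + (n + N : ℕ))⁻¹‖ ≤ 1 := by rw [norm_inv]; exact inv_le_one_of_one_le₀ hl
      push_cast at *
      linarith
  rw [pow_one]
  nlinarith [norm_nonneg (u N), n.cast_nonneg (α := ℝ)]

theorem digamma {x : ℂ} (hx : ∀ n : ℕ, x ≠ -n) : PolyGrowth fun n => Complex.digamma (x + n) := by
  refine of_increment x fun n => ?_
  rw [← Complex.digamma_apply_add_one]
  · push_cast; ring_nf
  · intro k hk
    apply hx (n + k)
    push_cast
    linear_combination hk

theorem summable_norm {u : ℕ → ℂ} (hu : PolyGrowth u) {r : ℝ} (h0 : 0 ≤ r) (hr : r < 1) :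
    Summable fun n => ‖u n‖ * r ^ n := by
  obtain ⟨C, K, hC, h⟩ := hu
  have h1 : Summable fun n : ℕ => (n : ℝ) ^ K * r ^ n :=
    summable_pow_mul_geometric_of_norm_lt_one K (by rwa [Real.norm_of_nonneg h0])
  have h2 : Summable fun n : ℕ => ((n : ℝ) + 1) ^ K * r ^ n := by
    have : Summable fun n : ℕ => (2 : ℝ) ^ K * ((n : ℝ) ^ K * r ^ n) + 1 * r ^ n :=
      (h1.mul_left _).add ((summable_geometric_of_lt_one h0 hr).mul_left _)
    refine this.of_nonneg_of_le (fun n => by positivity) fun n => ?_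
    rw [← mul_assoc, ← add_mul, ← mul_pow]
    gcongr
    rcases n with _ | n
    · simp
    · have : (((n + 1 : ℕ) : ℝ) + 1) ^ K ≤ (2 * ((n + 1 : ℕ) : ℝ)) ^ K := by
        gcongr; push_cast; linarith [n.cast_nonneg (α := ℝ)]
      linarith
  refine (h2.mul_left C).of_nonneg_of_le (fun n => by positivity) fun n => ?_
  rw [← mul_assoc]
  gcongr
  exact h n

theorem summable {u : ℕ → ℂ} (hu : PolyGrowth u) {z : ℂ} (hz : ‖z‖ < 1) :
    Summable fun n => u n * z ^ n :=
  Summable.of_norm (by simpa using hu.summable_norm (norm_nonneg z) hz)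

theorem hasDerivAt {u : ℕ → ℂ} (hu : PolyGrowth u) {z : ℂ} (hz : ‖z‖ < 1) :
    HasDerivAt (powerSum u) (powerSum (_root_.derivCoeff u) z) z := by
  obtain ⟨r, hzr, hr1⟩ := exists_between hz
  have hr0 : 0 ≤ r := (norm_nonneg z).trans hzr.le
  have hs := hu.derivCoeff.summable_norm hr0 hr1
  have hs' : Summable fun n : ℕ => ‖(n : ℂ) * u n‖ * r ^ (n - 1) := by
    refine (summable_nat_add_iff 1).1 ?_
    simpa [_root_.derivCoeff] using hs
  have key := hasDerivAt_tsum_of_isPreconnected (g := fun n z => u n * z ^ n)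
    (g' := fun n z => u n * (n * z ^ (n - 1))) (t := Metric.ball (0 : ℂ) r) (y₀ := 0) (y := z) hs'
    Metric.isOpen_ball (convex_ball _ _).isPreconnected
    (fun n y _ => (hasDerivAt_pow n y).const_mul (u n))
    (fun n y hy => by
      have hy : ‖y‖ < r := by simpa using hy
      rw [norm_mul, norm_mul, norm_pow, norm_mul]
      calc ‖u n‖ * (‖(n : ℂ)‖ * ‖y‖ ^ (n - 1)) ≤ ‖u n‖ * (‖(n : ℂ)‖ * r ^ (n - 1)) := by gcongr
        _ = _ := by ring)
    (by simpa using (norm_nonneg z).trans_lt hzr) (hu.summable (by simp)) (by simpa using hzr)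
  refine key.congr_deriv ?_
  have hsum : Summable fun n : ℕ => u n * (n * z ^ (n - 1)) := by
    refine Summable.of_norm (hs'.of_nonneg_of_le (fun n => norm_nonneg _) fun n => ?_)
    rw [norm_mul, norm_mul, norm_pow, norm_mul]
    calc ‖u n‖ * (‖(n : ℂ)‖ * ‖z‖ ^ (n - 1)) ≤ ‖u n‖ * (‖(n : ℂ)‖ * r ^ (n - 1)) := by gcongr
      _ = _ := by ring
  -- The term `n = 0` vanishes through its factor `n`, so the truncated exponent `n - 1` does no
  -- harm there.
  rw [hsum.tsum_eq_zero_add, powerSum]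
  simp only [Nat.cast_zero, zero_mul, mul_zero, zero_add]
  refine tsum_congr fun n => ?_
  simp only [_root_.derivCoeff, Nat.add_sub_cancel]
  push_cast
  ring

end PolyGrowth

/-! ### Differential operators acting on coefficients -/

theorem powerSum_zero (u : ℕ → ℂ) : powerSum u 0 = u 0 := by
  rw [powerSum, tsum_eq_single 0 (by intro n hn; simp [hn])]
  simp

theorem mul_powerSum_succ {u : ℕ → ℂ} (hu : PolyGrowth u) {z : ℂ} (hz : ‖z‖ < 1) :
    z * powerSum (fun n => u (n + 1)) z = powerSum u z - u 0 := by
  have := (hu.summable hz).tsum_eq_zero_add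
  rw [powerSum, powerSum, this, ← tsum_mul_left, pow_zero, mul_one, add_sub_cancel_left]
  exact tsum_congr fun n => by ring

theorem powerSum_add {u v : ℕ → ℂ} (hu : PolyGrowth u) (hv : PolyGrowth v) {z : ℂ} (hz : ‖z‖ < 1) :
    powerSum (fun n => u n + v n) z = powerSum u z + powerSum v z := by
  rw [powerSum, powerSum, powerSum, ← (hu.summable hz).tsum_add (hv.summable hz)]
  simp [add_mul]

theorem powerSum_const_mul (c : ℂ) (u : ℕ → ℂ) (z : ℂ) :
    powerSum (fun n => c * u n) z = c * powerSum u z := by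
  rw [powerSum, powerSum, ← tsum_mul_left]
  simp [mul_assoc]

theorem powerSum_sub {u v : ℕ → ℂ} (hu : PolyGrowth u) (hv : PolyGrowth v) {z : ℂ} (hz : ‖z‖ < 1) :
    powerSum (fun n => u n - v n) z = powerSum u z - powerSum v z := by
  rw [powerSum, powerSum, powerSum, ← (hu.summable hz).tsum_sub (hv.summable hz)]
  simp [sub_mul]

/-- Multiplication of a power series by `z`, read off the coefficients. -/
theorem mul_powerSum {u v : ℕ → ℂ} (hu : PolyGrowth u) (h0 : u 0 = 0) (h : ∀ n, u (n + 1) = v n)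
    {z : ℂ} (hz : ‖z‖ < 1) : z * powerSum v z = powerSum u z := by
  have := mul_powerSum_succ hu hz
  simpa [h, h0] using this

theorem mul_powerSum_derivCoeff {u : ℕ → ℂ} (hu : PolyGrowth u) {z : ℂ} (hz : ‖z‖ < 1) :
    z * powerSum (derivCoeff u) z = powerSum (fun n => n * u n) z :=
  mul_powerSum (.mul .natCast hu) (by simp) (fun n => by simp [derivCoeff]) hz

/-- The first-order operator `z (1 - z) d/dz + (p - e z)` on coefficients. -/
theorem powerSum_ladder {u v : ℕ → ℂ} (hu : PolyGrowth u) (p e : ℂ) (h0 : v 0 = p * u 0)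
    (h : ∀ n : ℕ, v (n + 1) = (n + 1 + p) * u (n + 1) - (n + e) * u n) {z : ℂ} (hz : ‖z‖ < 1) :
    z * (1 - z) * powerSum (derivCoeff u) z + (p - e * z) * powerSum u z = powerSum v z := by
  have hn : PolyGrowth fun n => (n : ℂ) * u n := .mul .natCast hu
  have g1 : PolyGrowth fun n => (n : ℂ) * u n + p * u n := hn.add (hu.const_mul p)
  have g2 : PolyGrowth fun n => (n : ℂ) * u n + e * u n := hn.add (hu.const_mul e)
  have hv : PolyGrowth v := by
    have := g1.succ.sub g2
    refine .of_succ ?_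
    convert this using 2 with n
    rw [h]
    push_cast
    ring
  have e1 := powerSum_add hn (hu.const_mul p) hz
  have e2 := powerSum_add hn (hu.const_mul e) hz
  have e3 : z * powerSum (fun n => (n : ℂ) * u n + e * u n) z = _ :=
    mul_powerSum (g1.sub hv) (by simp [h0]) (fun n => by rw [h]; push_cast; ring) hz
  rw [powerSum_sub g1 hv hz, e1, e2] at e3
  have e4 := mul_powerSum_derivCoeff hu hz
  rw [powerSum_const_mul] at e1 e2 e3
  rw [powerSum_const_mul] at e3
  linear_combination (1 - z) * e4 - e3

/-- The hypergeometric differential operator on coefficients. -/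
theorem powerSum_hypergeometric {u : ℕ → ℂ} (hu : PolyGrowth u) (a b c : ℂ) {z : ℂ}
    (hz : ‖z‖ < 1) :
    z * (1 - z) * powerSum (derivCoeff (derivCoeff u)) z +
        (c - (a + b + 1) * z) * powerSum (derivCoeff u) z - a * b * powerSum u z =
      powerSum (fun n => (n + 1) * (n + c) * u (n + 1) - (n + a) * (n + b) * u n) z := by
  have h1 := powerSum_ladder (v := fun n => (n + 1) * (n + c) * u (n + 1) - n * (n + a + b) * u n)
    hu.derivCoeff c (a + b + 1) (by simp [derivCoeff])
    (fun n => by simp only [derivCoeff]; push_cast; ring) hz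
  have g : PolyGrowth fun n : ℕ => (n + 1) * (n + c) * u (n + 1) - n * (n + a + b) * u n :=
    (((PolyGrowth.natCast.add (.const 1)).mul (.add .natCast (.const c))).mul hu.succ).sub
      ((PolyGrowth.natCast.mul ((PolyGrowth.natCast.add (.const a)).add (.const b))).mul hu)
  rw [h1, ← powerSum_const_mul, ← powerSum_sub g (hu.const_mul _) hz]
  congr 1
  ext n
  ring

/-! ### Pochhammer symbols, Gauss coefficients and their contiguity relations -/

theorem poch_zero (a : ℂ) : poch a 0 = 1 := by simp [poch]

theorem poch_succ (a : ℂ) (n : ℕ) : poch a (n + 1) = poch a n * (a + n) := by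
  simp [poch, ascPochhammer_succ_eval]

theorem poch_succ_left (a : ℂ) (n : ℕ) : poch a (n + 1) = a * poch (a + 1) n := by
  simp [poch, ascPochhammer_succ_left, Polynomial.eval_comp]

theorem poch_add (a : ℂ) (m n : ℕ) : poch a (m + n) = poch a m * poch (a + m) n := by
  induction n with
  | zero => simp [poch_zero]
  | succ n ih => rw [← add_assoc, poch_succ, poch_succ, ih]; push_cast; ring

theorem poch_one (n : ℕ) : poch 1 n = n.factorial := by
  simp [poch]

theorem poch_ne_zero {c : ℂ} (hc : ∀ n : ℕ, c ≠ -n) (n : ℕ) : poch c n ≠ 0 := by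
  induction n with
  | zero => simp [poch_zero]
  | succ n ih =>
    rw [poch_succ]
    exact mul_ne_zero ih fun h => hc n (eq_neg_of_add_eq_zero_left h)

/-- The coefficients of the Gauss hypergeometric series. -/
noncomputable def gaussCoeff (a b c : ℂ) (n : ℕ) : ℂ :=
  poch a n * poch b n / (poch c n * n.factorial)

theorem ordinaryHypergeometric_eq_powerSum (a b c z : ℂ) :
    ordinaryHypergeometric a b c z = powerSum (gaussCoeff a b c) z := by
  rw [ordinaryHypergeometric_eq_tsum, powerSum]
  refine tsum_congr fun n => ?_
  simp only [gaussCoeff, poch, smul_eq_mul, div_eq_mul_inv, mul_inv]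
  ring

theorem factorial_cast_ne_zero (n : ℕ) : (n.factorial : ℂ) ≠ 0 := by
  exact_mod_cast n.factorial_ne_zero

theorem cast_succ_ne_zero (n : ℕ) : (n : ℂ) + 1 ≠ 0 := by exact_mod_cast n.succ_ne_zero

theorem polyGrowth_poch_div_factorial (a : ℂ) :
    PolyGrowth fun n => poch a n / n.factorial := by
  refine .of_recurrence a fun n => ?_
  rw [poch_succ, Nat.factorial_succ]
  push_cast
  have := factorial_cast_ne_zero n
  have := cast_succ_ne_zero n
  field_simp

theorem polyGrowth_factorial_div_poch (c : ℂ) :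
    PolyGrowth fun n => (n.factorial : ℂ) / poch c n := by
  refine .of_inv_recurrence c fun n => ?_
  rw [poch_succ, Nat.factorial_succ]
  push_cast
  rw [mul_comm ((n : ℂ) + 1), mul_div_mul_comm]

theorem polyGrowth_gaussCoeff (a b c : ℂ) : PolyGrowth (gaussCoeff a b c) := by
  convert ((polyGrowth_poch_div_factorial a).mul (polyGrowth_poch_div_factorial b)).mul
    (polyGrowth_factorial_div_poch c) using 2 with n
  have := factorial_cast_ne_zero n
  simp only [gaussCoeff, div_eq_mul_inv, mul_inv]
  field_simp

theorem gaussCoeff_zero (a b c : ℂ) : gaussCoeff a b c 0 = 1 := by simp [gaussCoeff, poch_zero]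

theorem gaussCoeff_succ (a b c : ℂ) (n : ℕ) (hc : ∀ n : ℕ, c ≠ -n) :
    (n + 1) * (c + n) * gaussCoeff a b c (n + 1) = (a + n) * (b + n) * gaussCoeff a b c n := by
  have := factorial_cast_ne_zero n
  have := cast_succ_ne_zero n
  have := poch_ne_zero hc n
  have h : c + n ≠ 0 := fun h => hc n (eq_neg_of_add_eq_zero_left h)
  simp only [gaussCoeff, poch_succ, Nat.factorial_succ]
  push_cast
  field_simp

theorem add_nat_ne_neg {c : ℂ} (hc : ∀ n : ℕ, c ≠ -n) (k : ℕ) : ∀ n : ℕ, c + k ≠ -n := by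
  intro n h
  refine hc (n + k) ?_
  push_cast
  linear_combination h

/-- Coefficient form of c F = z(1-z) G' + (c - (a+b+1)z) G, where G has all three parameters raised
by one. Passing from G to F increases the excess c - a - b by one. -/
theorem gaussCoeff_ladder_both (a b c : ℂ) (hc : ∀ n : ℕ, c ≠ -n) (n : ℕ) :
    c * gaussCoeff a b c (n + 1) = (n + 1 + c) * gaussCoeff (a + 1) (b + 1) (c + 1) (n + 1) -
      (n + (a + b + 1)) * gaussCoeff (a + 1) (b + 1) (c + 1) n := by
  have := factorial_cast_ne_zero n
  have := cast_succ_ne_zero n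
  have hc' : ∀ n : ℕ, c + 1 ≠ -n := by simpa using add_nat_ne_neg hc 1
  have := poch_ne_zero hc' n
  have h : c + 1 + n ≠ 0 := fun h => hc' n (eq_neg_of_add_eq_zero_left h)
  have h0 : c ≠ 0 := by simpa using hc 0
  simp only [gaussCoeff, poch_succ (a + 1), poch_succ (b + 1), poch_succ (c + 1),
    poch_succ_left a, poch_succ_left b, poch_succ_left c, Nat.factorial_succ]
  push_cast
  field_simp
  ring

/-- The companion relation c F = z(1-z) G' + (c - bz) G, which lowers only a and c and so keeps the
excess c - a - b. -/
theorem gaussCoeff_ladder_left (a b c : ℂ) (hc : ∀ n : ℕ, c ≠ -n) (n : ℕ) :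
    c * gaussCoeff a b c (n + 1) = (n + 1 + c) * gaussCoeff (a + 1) b (c + 1) (n + 1) -
      (n + b) * gaussCoeff (a + 1) b (c + 1) n := by
  have := factorial_cast_ne_zero n
  have := cast_succ_ne_zero n
  have hc' : ∀ n : ℕ, c + 1 ≠ -n := by simpa using add_nat_ne_neg hc 1
  have := poch_ne_zero hc' n
  have h : c + 1 + n ≠ 0 := fun h => hc' n (eq_neg_of_add_eq_zero_left h)
  have h0 : c ≠ 0 := by simpa using hc 0
  simp only [gaussCoeff, poch_succ (a + 1), poch_succ b, poch_succ (c + 1),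
    poch_succ_left a, poch_succ_left c, Nat.factorial_succ]
  push_cast
  field_simp
  ring

/-! ### Coefficients of the logarithmic expansion and their recurrences -/

/-- The coefficients of `log w` in the expansion at `w = 1 - z = 0`. -/
noncomputable def logCoeff (a b : ℂ) (m n : ℕ) : ℂ :=
  if n < m then 0
  else -(-1) ^ m * (poch a n * poch b n) / (n.factorial * (n - m).factorial)

/-- The coefficients of the part free of logarithms in the expansion at `w = 1 - z = 0`. -/
noncomputable def regCoeff (a b : ℂ) (m n : ℕ) : ℂ :=
  if n < m then (-1) ^ n * (poch a n * poch b n * (m - n - 1).factorial) / n.factorial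
  else logCoeff a b m n * (Complex.digamma (a + n) + Complex.digamma (b + n) -
    Complex.digamma (n + 1) - Complex.digamma ((n - m : ℕ) + 1))

theorem polyGrowth_logCoeff (a b : ℂ) (m : ℕ) : PolyGrowth (logCoeff a b m) := by
  refine .of_add m ?_
  have h1 : PolyGrowth fun n => poch a (n + m) / n.factorial := by
    refine .of_recurrence (a + m) fun n => ?_
    rw [show n + 1 + m = n + m + 1 by ring, poch_succ, Nat.factorial_succ]
    push_cast
    have := factorial_cast_ne_zero n
    have := cast_succ_ne_zero n
    field_simp
    ring
  have h2 := (polyGrowth_poch_div_factorial b).shift m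
  convert (h1.mul h2).const_mul (-(-1) ^ m) using 2 with n
  simp only [logCoeff, Nat.add_sub_cancel, if_neg (show ¬ n + m < m by omega)]
  have := factorial_cast_ne_zero n
  have := factorial_cast_ne_zero (n + m)
  field_simp

theorem polyGrowth_digamma_nat : PolyGrowth fun n => Complex.digamma (n + 1) := by
  have := PolyGrowth.digamma (x := 1) (fun n h => by
    have := congrArg Complex.re h
    simp at this
    linarith [n.cast_nonneg (α := ℝ)])
  simpa [add_comm] using this

theorem polyGrowth_regCoeff {a b : ℂ} (m : ℕ) (ha : ∀ n : ℕ, a + m ≠ -n)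
    (hb : ∀ n : ℕ, b + m ≠ -n) : PolyGrowth (regCoeff a b m) := by
  refine .of_add m ?_
  have hlog := (polyGrowth_logCoeff a b m).shift m
  convert hlog.mul ((((PolyGrowth.digamma ha).add (.digamma hb)).sub
    (polyGrowth_digamma_nat.shift m)).sub polyGrowth_digamma_nat) using 2 with n
  simp only [regCoeff, Nat.add_sub_cancel, if_neg (show ¬ n + m < m by omega)]
  push_cast
  ring_nf

theorem digamma_nat_add_one (n : ℕ) :
    Complex.digamma ((n : ℂ) + 1 + 1) = Complex.digamma (n + 1) + ((n : ℂ) + 1)⁻¹ := by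
  refine Complex.digamma_apply_add_one _ fun k h => ?_
  have := congrArg Complex.re h
  simp at this
  linarith [n.cast_nonneg (α := ℝ), k.cast_nonneg (α := ℝ)]

theorem logCoeff_ladder_both (a b : ℂ) (m n : ℕ) :
    logCoeff a b (m + 1) (n + 1) = -(n + 1 - m) * logCoeff (a + 1) (b + 1) m (n + 1) +
      (n + (a + b + 1)) * logCoeff (a + 1) (b + 1) m n := by
  rcases lt_trichotomy (n + 1) m with h | h | h
  · simp [logCoeff, h, show n < m by omega]
  · subst h
    simp [logCoeff]
  · obtain ⟨k, rfl⟩ : ∃ k, n = m + k := ⟨n - m, by omega⟩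
    simp only [logCoeff, if_neg (show ¬ m + k + 1 < m + 1 by omega),
      if_neg (show ¬ m + k + 1 < m by omega), if_neg (show ¬ m + k < m by omega),
      show m + k + 1 - (m + 1) = k by omega, show m + k + 1 - m = k + 1 by omega,
      show m + k - m = k by omega]
    have := factorial_cast_ne_zero k
    have := cast_succ_ne_zero k
    have := factorial_cast_ne_zero (m + k)
    have : (m : ℂ) + k + 1 ≠ 0 := by exact_mod_cast (m + k).succ_ne_zero
    simp only [poch_succ (a + 1), poch_succ (b + 1), poch_succ_left a, poch_succ_left b,
      Nat.factorial_succ]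
    push_cast
    field_simp
    ring

/-- The two `logCoeff` terms come from differentiating the logarithm: -w(1-w) · Q/w = -(1-w) Q feeds
into the part free of logarithms. -/
theorem regCoeff_ladder_both (a b : ℂ) (m n : ℕ) (ha : ∀ n : ℕ, a + 1 + m ≠ -n)
    (hb : ∀ n : ℕ, b + 1 + m ≠ -n) :
    regCoeff a b (m + 1) (n + 1) = -(n + 1 - m) * regCoeff (a + 1) (b + 1) m (n + 1) +
      (n + (a + b + 1)) * regCoeff (a + 1) (b + 1) m n - logCoeff (a + 1) (b + 1) m (n + 1) +
      logCoeff (a + 1) (b + 1) m n := by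
  have hn1 := cast_succ_ne_zero n
  have hn := factorial_cast_ne_zero n
  rcases lt_trichotomy (n + 1) m with h | h | h
  · obtain ⟨k, rfl⟩ : ∃ k, m = n + 1 + 1 + k := ⟨m - (n + 2), by omega⟩
    simp only [regCoeff, logCoeff, if_pos h, if_pos (show n + 1 < n + 1 + 1 + k + 1 by omega),
      if_pos (show n < n + 1 + 1 + k by omega),
      show n + 1 + 1 + k + 1 - (n + 1) - 1 = k + 1 by omega,
      show n + 1 + 1 + k - (n + 1) - 1 = k by omega, show n + 1 + 1 + k - n - 1 = k + 1 by omega,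
      poch_succ (a + 1), poch_succ (b + 1), poch_succ_left a, poch_succ_left b,
      Nat.factorial_succ, pow_succ]
    push_cast
    field_simp
    ring
  -- At the junction `n + 1 = m` the factor `n + 1 - m` removes the digamma values, and the leading
  -- logarithmic coefficient supplies the missing rational term.
  · subst h
    simp only [regCoeff, logCoeff, lt_irrefl, if_false, if_pos (show n + 1 < n + 1 + 1 by omega),
      if_pos (show n < n + 1 by omega), show n + 1 + 1 - (n + 1) - 1 = 0 by omega,
      show n + 1 - n - 1 = 0 by omega, Nat.sub_self,
      poch_succ (a + 1), poch_succ (b + 1), poch_succ_left a, poch_succ_left b,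
      Nat.factorial_succ, pow_succ, Nat.factorial_zero]
    push_cast
    field_simp
    ring
  · obtain ⟨k, rfl⟩ : ∃ k, n = m + k := ⟨n - m, by omega⟩
    -- The common digamma bracket satisfies the logarithmic recurrence; shifting its arguments by
    -- one leaves only a rational identity.
    have key := logCoeff_ladder_both a b m (m + k)
    have ha' := Complex.digamma_apply_add_one (a + 1 + (m + k : ℕ))
      (by simpa [add_assoc] using add_nat_ne_neg ha k)
    have hb' := Complex.digamma_apply_add_one (b + 1 + (m + k : ℕ))
      (by simpa [add_assoc] using add_nat_ne_neg hb k)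
    have ha0 : a + 1 + (m + k : ℕ) ≠ 0 := by
      simpa [add_assoc] using add_nat_ne_neg ha k 0
    have hb0 : b + 1 + (m + k : ℕ) ≠ 0 := by
      simpa [add_assoc] using add_nat_ne_neg hb k 0
    have hm := digamma_nat_add_one (m + k)
    have hk := digamma_nat_add_one k
    simp only [regCoeff, if_neg (show ¬ m + k + 1 < m + 1 by omega),
      if_neg (show ¬ m + k + 1 < m by omega), if_neg (show ¬ m + k < m by omega),
      show m + k + 1 - (m + 1) = k by omega, show m + k + 1 - m = k + 1 by omega,
      show m + k - m = k by omega]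
    rw [key]
    have e1 : a + ((m + k + 1 : ℕ) : ℂ) = a + 1 + (m + k : ℕ) := by push_cast; ring
    have e2 : b + ((m + k + 1 : ℕ) : ℂ) = b + 1 + (m + k : ℕ) := by push_cast; ring
    have e3 : a + 1 + ((m + k + 1 : ℕ) : ℂ) = a + 1 + (m + k : ℕ) + 1 := by push_cast; ring
    have e4 : b + 1 + ((m + k + 1 : ℕ) : ℂ) = b + 1 + (m + k : ℕ) + 1 := by push_cast; ring
    have e5 : ((m + k + 1 : ℕ) : ℂ) + 1 = (m + k : ℕ) + 1 + 1 := by push_cast; ring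
    have e6 : ((k + 1 : ℕ) : ℂ) + 1 = (k : ℂ) + 1 + 1 := by push_cast; ring
    rw [e1, e2, e3, e4, e5, e6, ha', hb', hm, hk]
    have hlog : logCoeff (a + 1) (b + 1) m (m + k + 1) = logCoeff (a + 1) (b + 1) m (m + k) *
        ((a + 1 + (m + k : ℕ)) * (b + 1 + (m + k : ℕ)) / (((m + k : ℕ) + 1) * (k + 1))) := by
      simp only [logCoeff, if_neg (show ¬ m + k + 1 < m by omega),
        if_neg (show ¬ m + k < m by omega), show m + k + 1 - m = k + 1 by omega,
        show m + k - m = k by omega, poch_succ, Nat.factorial_succ]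
      have := factorial_cast_ne_zero k
      have := cast_succ_ne_zero k
      push_cast at *
      field_simp
    rw [hlog]
    have := cast_succ_ne_zero k
    push_cast at *
    field_simp
    ring

theorem logCoeff_ladder_left {a : ℂ} (b : ℂ) (n : ℕ) :
    a * logCoeff a b 0 (n + 1) = -(n + 1 - a) * logCoeff (a + 1) b 0 (n + 1) +
      (n + b) * logCoeff (a + 1) b 0 n := by
  have := factorial_cast_ne_zero n
  have := cast_succ_ne_zero n
  simp only [logCoeff, Nat.not_lt_zero, if_false, Nat.sub_zero, Nat.factorial_succ,
    poch_succ (a + 1), poch_succ b, poch_succ_left a]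
  push_cast
  field_simp
  ring

theorem regCoeff_ladder_left {a b : ℂ} (n : ℕ) (ha : ∀ n : ℕ, a ≠ -n) (hb : ∀ n : ℕ, b ≠ -n) :
    a * regCoeff a b 0 (n + 1) = -(n + 1 - a) * regCoeff (a + 1) b 0 (n + 1) +
      (n + b) * regCoeff (a + 1) b 0 n - logCoeff (a + 1) b 0 (n + 1) +
      logCoeff (a + 1) b 0 n := by
  have key := logCoeff_ladder_left (a := a) b n
  have ha1 : ∀ n : ℕ, a + 1 ≠ -n := by simpa using add_nat_ne_neg ha 1
  have ha' := Complex.digamma_apply_add_one (a + 1 + n) (add_nat_ne_neg ha1 n)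
  have hb' := Complex.digamma_apply_add_one (b + n) (add_nat_ne_neg hb n)
  have ha0 : a + 1 + n ≠ 0 := by simpa using add_nat_ne_neg ha1 n 0
  have hb0 : b + n ≠ 0 := by simpa using add_nat_ne_neg hb n 0
  have hn := digamma_nat_add_one n
  have hn1 := cast_succ_ne_zero n
  simp only [regCoeff, Nat.not_lt_zero, if_false, Nat.sub_zero]
  rw [← mul_assoc, key]
  have e1 : a + ((n + 1 : ℕ) : ℂ) = a + 1 + n := by push_cast; ring
  have e2 : b + ((n + 1 : ℕ) : ℂ) = b + n + 1 := by push_cast; ring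
  have e3 : a + 1 + ((n + 1 : ℕ) : ℂ) = a + 1 + n + 1 := by push_cast; ring
  have e5 : ((n + 1 : ℕ) : ℂ) + 1 = n + 1 + 1 := by push_cast; ring
  rw [e1, e2, e3, e5, ha', hb', hn]
  have hlog : logCoeff (a + 1) b 0 (n + 1) = logCoeff (a + 1) b 0 n *
      ((a + 1 + n) * (b + n) / ((n + 1) * (n + 1))) := by
    simp only [logCoeff, Nat.not_lt_zero, if_false, Nat.sub_zero, Nat.factorial_succ, poch_succ]
    have := factorial_cast_ne_zero n
    push_cast
    field_simp
  rw [hlog]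
  field_simp
  ring

/-! ### The cut plane and transport of the principal branch -/

theorem isOpen_cutPlane : IsOpen cutPlane :=
  Complex.isOpen_slitPlane.preimage (by fun_prop)

theorem one_sub_mem_cutPlane {w : ℂ} (hw : w ∈ Complex.slitPlane) : 1 - w ∈ cutPlane := by
  simpa [cutPlane] using hw

theorem isPreconnected_cutPlane : IsPreconnected cutPlane := by
  have h := (Complex.starConvex_one_slitPlane.isPathConnected
    Complex.one_mem_slitPlane).isConnected.isPreconnected
  have e : cutPlane = (fun w : ℂ => 1 - w) '' Complex.slitPlane := by
    ext z
    simp only [cutPlane, Set.mem_ofPred_eq, Set.mem_image]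
    exact ⟨fun h => ⟨1 - z, h, by ring⟩, by rintro ⟨w, hw, rfl⟩; simpa using hw⟩
  rw [e]
  exact h.image _ (by fun_prop)

theorem mem_cutPlane_of_norm_lt_one {z : ℂ} (hz : ‖z‖ < 1) : z ∈ cutPlane := by
  simpa [cutPlane, sub_eq_add_neg] using
    Complex.mem_slitPlane_of_norm_lt_one (z := -z) (by simpa using hz)

theorem IsGaussPrincipalBranch.eqOn {a b c : ℂ} {F G : ℂ → ℂ} (hF : IsGaussPrincipalBranch a b c F)
    (hG : IsGaussPrincipalBranch a b c G) : Set.EqOn F G cutPlane := by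
  refine (hF.1.analyticOnNhd isOpen_cutPlane).eqOn_of_preconnected_of_eventuallyEq
    (hG.1.analyticOnNhd isOpen_cutPlane) isPreconnected_cutPlane
    (mem_cutPlane_of_norm_lt_one (z := 0) (by simp)) ?_
  filter_upwards [Metric.ball_mem_nhds (0 : ℂ) one_pos] with z hz
  have hz : ‖z‖ < 1 := by simpa using hz
  rw [hF.2 z hz, hG.2 z hz]

theorem IsGaussPrincipalBranch.gaussF {a b c : ℂ} {F : ℂ → ℂ}
    (hF : IsGaussPrincipalBranch a b c F) : IsGaussPrincipalBranch a b c (gaussF a b c) := by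
  have h : ∃ F : ℂ → ℂ, IsGaussPrincipalBranch a b c F := ⟨F, hF⟩
  rw [_root_.gaussF, dif_pos h]
  exact h.choose_spec

theorem IsGaussPrincipalBranch.ladder {a b c a' b' e : ℂ} {F : ℂ → ℂ}
    (hF : IsGaussPrincipalBranch a' b' (c + 1) F) (hc : c ≠ 0)
    (hcoeff : ∀ n, c * gaussCoeff a b c (n + 1) = (n + 1 + c) * gaussCoeff a' b' (c + 1) (n + 1) -
      (n + e) * gaussCoeff a' b' (c + 1) n) :
    IsGaussPrincipalBranch a b c
      (fun z => c⁻¹ * (z * (1 - z) * deriv F z + (c - e * z) * F z)) := by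
  refine ⟨?_, fun z hz => ?_⟩
  · have hd := hF.1.deriv isOpen_cutPlane
    have h1 := hF.1
    fun_prop
  · have hu := polyGrowth_gaussCoeff a' b' (c + 1)
    have heq : F =ᶠ[nhds z] powerSum (gaussCoeff a' b' (c + 1)) := by
      filter_upwards [Metric.isOpen_ball.mem_nhds (show z ∈ Metric.ball (0 : ℂ) 1 by simpa using hz)]
        with x hx
      rw [hF.2 x (by simpa using hx), ordinaryHypergeometric_eq_powerSum]
    simp only
    rw [heq.deriv_eq, heq.eq_of_nhds, (hu.hasDerivAt hz).deriv,
      powerSum_ladder (v := fun n => c * gaussCoeff a b c n) hu c e (by simp [gaussCoeff_zero])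
        hcoeff hz,
      powerSum_const_mul, inv_mul_cancel_left₀ hc, ordinaryHypergeometric_eq_powerSum]

/-- The first-order operators `-w (1 - w) d/dw + (p + e w)` on expansions with a logarithm. -/
theorem powerSum_log_ladder {P Q P' Q' : ℕ → ℂ} {p e : ℂ} (hP : PolyGrowth P) (hQ : PolyGrowth Q)
    (hP0 : P' 0 = p * P 0 - Q 0) (hQ0 : Q' 0 = p * Q 0)
    (hP' : ∀ n : ℕ, P' (n + 1) = -(n + 1 - p) * P (n + 1) + (n + e) * P n - Q (n + 1) + Q n)
    (hQ' : ∀ n : ℕ, Q' (n + 1) = -(n + 1 - p) * Q (n + 1) + (n + e) * Q n)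
    {w : ℂ} (hw : ‖w‖ < 1) (hw' : w ∈ Complex.slitPlane) :
    ∃ H', HasDerivAt (fun w => powerSum P w + Complex.log w * powerSum Q w) H' w ∧
      -(w * (1 - w)) * H' + (p + e * w) * (powerSum P w + Complex.log w * powerSum Q w) =
        powerSum P' w + Complex.log w * powerSum Q' w := by
  have hw0 : w ≠ 0 := Complex.slitPlane_ne_zero hw'
  -- `P'` and `Q'` are the coefficients of the image under the operator, not of a derivative; only
  -- `H'` is a derivative.
  refine ⟨_, (hP.hasDerivAt hw).add ((Complex.hasDerivAt_log hw').mul (hQ.hasDerivAt hw)), ?_⟩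
  have hR : PolyGrowth fun n => Q n - P' n := by
    refine .of_succ ?_
    convert ((((PolyGrowth.natCast.add (.const 1)).sub (.const p)).mul hP.succ).sub
      ((PolyGrowth.natCast.add (.const e)).mul hP)).add ((hQ.succ.add hQ.succ).sub hQ)
      using 2 with n
    rw [hP']
    ring
  have hQP : PolyGrowth Q' := by
    refine .of_succ ?_
    convert (((PolyGrowth.natCast.add (.const e)).mul hQ).sub
      (((PolyGrowth.natCast.add (.const 1)).sub (.const p)).mul hQ.succ)) using 2 with n
    rw [hQ']
    ring
  have hPP : PolyGrowth P' := by
    convert hQ.sub hR using 2 with n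
    ring
  have e1 := powerSum_ladder (v := fun n => -Q' n) hQ (-p) e (by simp [hQ0])
    (fun n => by rw [hQ']; ring) hw
  have hmul : w * powerSum Q w = powerSum (fun n => -(-1 * (if n = 0 then 0 else Q (n - 1)))) w := by
    refine mul_powerSum (.of_succ ?_) (by simp) (fun n => by simp) hw
    simpa using hQ
  have hsh : PolyGrowth fun n => if n = 0 then 0 else Q (n - 1) := .of_succ (by simpa using hQ)
  have e2 := powerSum_ladder (v := fun n => -1 * (P' n + (Q n - if n = 0 then 0 else Q (n - 1))))
    hP (-p) e (by simp [hP0]) (fun n => by rw [hP']; simp; ring) hw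
  rw [powerSum_const_mul, powerSum_add hPP (hQ.sub hsh) hw, powerSum_sub hQ hsh hw] at e2
  simp only [neg_mul, one_mul, neg_neg] at hmul
  rw [← hmul] at e2
  have e1' : powerSum (fun n => -Q' n) w = -powerSum Q' w := by
    simpa using powerSum_const_mul (-1) Q' w
  rw [e1'] at e1
  have hinv : w * w⁻¹ = 1 := mul_inv_cancel₀ hw0
  linear_combination -e2 - Complex.log w * e1 - (1 - w) * powerSum Q w * hinv

/-! ### Transport of the logarithmic expansion to all parameters -/

/-- The Gauss function with parameters `a, b; a + b + m` has a principal branch, with the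
logarithmic expansion at `z = 1`. -/
def HasLogExpansion (a b : ℂ) (m : ℕ) : Prop :=
  ∃ F : ℂ → ℂ, IsGaussPrincipalBranch a b (a + b + m) F ∧
    ∀ w : ℂ, ‖w‖ < 1 → w ∈ Complex.slitPlane →
      Complex.Gamma (a + m) * Complex.Gamma (b + m) / Complex.Gamma (a + b + m) * F (1 - w) =
        powerSum (regCoeff a b m) w + Complex.log w * powerSum (logCoeff a b m) w

/-- The expansion holds on an open set, so it may be differentiated. Under z = 1 - w the operator
z(1-z) d/dz + (c - ez) becomes -w(1-w) d/dw + (p + ew) with p = c - e. -/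
theorem IsGaussPrincipalBranch.expansion_ladder {c a' b' e K p : ℂ} {P Q P' Q' : ℕ → ℂ}
    {F : ℂ → ℂ} (hF : IsGaussPrincipalBranch a' b' (c + 1) F) (hp : p + e = c)
    (hexp : ∀ w : ℂ, ‖w‖ < 1 → w ∈ Complex.slitPlane →
      K * F (1 - w) = powerSum P w + Complex.log w * powerSum Q w)
    (hP : PolyGrowth P) (hQ : PolyGrowth Q)
    (hP0 : P' 0 = p * P 0 - Q 0) (hQ0 : Q' 0 = p * Q 0)
    (hP' : ∀ n : ℕ, P' (n + 1) = -(n + 1 - p) * P (n + 1) + (n + e) * P n - Q (n + 1) + Q n)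
    (hQ' : ∀ n : ℕ, Q' (n + 1) = -(n + 1 - p) * Q (n + 1) + (n + e) * Q n)
    {w : ℂ} (hw : ‖w‖ < 1) (hw' : w ∈ Complex.slitPlane) :
    K * ((1 - w) * (1 - (1 - w)) * deriv F (1 - w) + (c - e * (1 - w)) * F (1 - w)) =
      powerSum P' w + Complex.log w * powerSum Q' w := by
  obtain ⟨H', hH', e1⟩ := powerSum_log_ladder hP hQ hP0 hQ0 hP' hQ' hw hw'
  have hd : HasDerivAt (fun w => K * F (1 - w)) (K * (deriv F (1 - w) * -1)) w := by
    have h1 : HasDerivAt F (deriv F (1 - w)) (1 - w) :=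
      ((hF.1 _ (one_sub_mem_cutPlane hw')).differentiableAt
        (isOpen_cutPlane.mem_nhds (one_sub_mem_cutPlane hw'))).hasDerivAt
    exact (h1.comp w ((hasDerivAt_id w).const_sub 1)).const_mul K
  have heq : (fun w => K * F (1 - w)) =ᶠ[nhds w]
      fun w => powerSum P w + Complex.log w * powerSum Q w := by
    filter_upwards [Metric.isOpen_ball.mem_nhds (show w ∈ Metric.ball (0 : ℂ) 1 by simpa using hw),
      Complex.isOpen_slitPlane.mem_nhds hw'] with x hx hx'
    exact hexp x (by simpa using hx) hx'
  have e2 := (hd.congr_of_eventuallyEq heq.symm).unique hH'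
  rw [← e1, ← e2, ← hexp w hw hw']
  linear_combination -K * F (1 - w) * hp

theorem HasLogExpansion.symm {a b : ℂ} {m : ℕ} (h : HasLogExpansion a b m) :
    HasLogExpansion b a m := by
  obtain ⟨F, ⟨hd, hF⟩, hexp⟩ := h
  refine ⟨F, ⟨hd, fun z hz => ?_⟩, fun w hw hw' => ?_⟩
  · rw [hF z hz, ordinaryHypergeometric_eq_powerSum, ordinaryHypergeometric_eq_powerSum]
    congr 1
    ext n
    simp only [gaussCoeff, add_comm b a, mul_comm (poch b n)]
  · have := hexp w hw hw'
    have e1 : logCoeff b a m = logCoeff a b m := by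
      ext n; simp only [logCoeff, mul_comm (poch b n)]
    have e2 : regCoeff b a m = regCoeff a b m := by
      ext n
      simp only [regCoeff, e1, mul_comm (poch b n), add_comm (Complex.digamma (b + n))]
    rw [e1, e2, ← this, mul_comm (Complex.Gamma (b + m)), add_comm b a]

theorem HasLogExpansion.both {a b : ℂ} {m : ℕ} (h : HasLogExpansion (a + 1) (b + 1) m)
    (ha : ∀ n : ℕ, a + 1 + m ≠ -n) (hb : ∀ n : ℕ, b + 1 + m ≠ -n)
    (hc : ∀ n : ℕ, a + b + (m + 1) ≠ -n) : HasLogExpansion a b (m + 1) := by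
  obtain ⟨F, hF, hexp⟩ := h
  have hc0 : a + b + (m + 1) ≠ 0 := by simpa using hc 0
  have ec : a + 1 + (b + 1) + m = a + b + (m + 1) + 1 := by ring
  rw [ec] at hF
  refine ⟨_, by push_cast; exact hF.ladder hc0 (gaussCoeff_ladder_both a b _ hc), ?_⟩
  intro w hw hw'
  have hP0 : regCoeff a b (m + 1) 0 =
      m * regCoeff (a + 1) (b + 1) m 0 - logCoeff (a + 1) (b + 1) m 0 := by
    rcases m with _ | m
    · simp [regCoeff, logCoeff, poch_zero]
    · simp [regCoeff, logCoeff, poch_zero, Nat.factorial_succ]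
  have hQ0 : logCoeff a b (m + 1) 0 = m * logCoeff (a + 1) (b + 1) m 0 := by
    rcases m with _ | m <;> simp [logCoeff]
  have key := hF.expansion_ladder (show (m : ℂ) + (a + b + 1) = _ by ring) hexp
    (polyGrowth_regCoeff m ha hb) (polyGrowth_logCoeff _ _ m) hP0 hQ0
    (fun n => regCoeff_ladder_both a b m n ha hb) (fun n => logCoeff_ladder_both a b m n) hw hw'
  rw [← key, ec, Complex.Gamma_add_one _ hc0]
  push_cast
  rw [show a + 1 + m = a + (m + 1) by ring, show b + 1 + m = b + (m + 1) by ring]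
  have := Complex.Gamma_ne_zero hc
  field_simp

theorem HasLogExpansion.left {a b : ℂ} (h : HasLogExpansion (a + 1) b 0)
    (ha : ∀ n : ℕ, a ≠ -n) (hb : ∀ n : ℕ, b ≠ -n)
    (hc : ∀ n : ℕ, a + b ≠ -n) : HasLogExpansion a b 0 := by
  obtain ⟨F, hF, hexp⟩ := h
  have hc0 : a + b ≠ 0 := by simpa using hc 0
  have ha0 : a ≠ 0 := by simpa using ha 0
  have ec : a + 1 + b + (0 : ℕ) = a + b + 1 := by simp; ring
  rw [ec] at hF
  refine ⟨_, by simpa using hF.ladder hc0 (gaussCoeff_ladder_left a b _ hc), ?_⟩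
  intro w hw hw'
  -- The factor `a` throughout is Γ(a+1)/Γ(a), the change in the normalising constant.
  have hP0 : a * regCoeff a b 0 0 = a * regCoeff (a + 1) b 0 0 - logCoeff (a + 1) b 0 0 := by
    simp [regCoeff, logCoeff, poch_zero]
    rw [Complex.digamma_apply_add_one a ha]
    field_simp
    ring
  have hQ0 : a * logCoeff a b 0 0 = a * logCoeff (a + 1) b 0 0 := by
    simp [logCoeff, poch_zero]
  have ha1 : ∀ n : ℕ, a + 1 ≠ -n := by simpa using add_nat_ne_neg ha 1
  have key := hF.expansion_ladder (P' := fun n => a * regCoeff a b 0 n)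
    (Q' := fun n => a * logCoeff a b 0 n) (show a + b = _ by ring) hexp
    (polyGrowth_regCoeff 0 (by simpa using ha1) (by simpa using hb)) (polyGrowth_logCoeff _ _ 0)
    hP0 hQ0 (fun n => regCoeff_ladder_left n ha hb) (fun n => logCoeff_ladder_left b n) hw hw'
  rw [powerSum_const_mul, powerSum_const_mul, ec, Complex.Gamma_add_one _ hc0] at key
  simp only [Nat.cast_zero, add_zero] at key ⊢
  rw [Complex.Gamma_add_one _ ha0] at key
  have := Complex.Gamma_ne_zero hc
  apply mul_left_cancel₀ ha0
  refine Eq.trans ?_ (key.trans (by ring))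
  field_simp

theorem hasLogExpansion_of_base
    (base : ∀ a b : ℂ, 2 ≤ a.re → 2 ≤ b.re → HasLogExpansion a b 0) (a b : ℂ) (m : ℕ)
    (ha : ∀ n : ℕ, a + m ≠ -n) (hb : ∀ n : ℕ, b + m ≠ -n) (hc : ∀ n : ℕ, a + b + m ≠ -n) :
    HasLogExpansion a b m := by
  -- Lower Re a one unit at a time while Re b ≥ 2.
  have step1 : ∀ (N : ℕ) (a b : ℂ), 2 - N ≤ a.re → 2 ≤ b.re → (∀ n : ℕ, a ≠ -n) →
      (∀ n : ℕ, a + b ≠ -n) → HasLogExpansion a b 0 := by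
    intro N
    induction N with
    | zero => intro a b h1 h2 _ _; exact base a b (by simpa using h1) h2
    | succ N ih =>
      intro a b h1 h2 ha hc
      have hb : ∀ n : ℕ, b ≠ -n := fun n h => by
        have := congrArg Complex.re h
        simp at this
        linarith [n.cast_nonneg (α := ℝ)]
      refine .left (ih (a + 1) b ?_ h2 (by simpa using add_nat_ne_neg ha 1) ?_) ha hb hc
      · push_cast at h1
        simp
        linarith
      · simpa [add_right_comm] using add_nat_ne_neg hc 1
  -- Then lower Re b with a free; the pair is swapped because `HasLogExpansion.left` moves the first
  -- parameter.
  have step2 : ∀ (N : ℕ) (a b : ℂ), 2 - N ≤ b.re → (∀ n : ℕ, a ≠ -n) → (∀ n : ℕ, b ≠ -n) →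
      (∀ n : ℕ, a + b ≠ -n) → HasLogExpansion b a 0 := by
    intro N
    induction N with
    | zero =>
      intro a b h1 ha hb hc
      obtain ⟨M, hM⟩ := exists_nat_ge (2 - a.re)
      exact (step1 M a b (by linarith) (by simpa using h1) ha hc).symm
    | succ N ih =>
      intro a b h1 ha hb hc
      refine .left (ih a (b + 1) ?_ ha (by simpa using add_nat_ne_neg hb 1) ?_) hb ha
        (by simpa [add_comm] using hc)
      · push_cast at h1
        simp
        linarith
      · simpa [add_assoc] using add_nat_ne_neg hc 1
  induction m generalizing a b with
  | zero =>
    obtain ⟨M, hM⟩ := exists_nat_ge (2 - b.re)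
    simp only [Nat.cast_zero, add_zero] at ha hb hc
    exact (step2 M a b (by linarith) ha hb hc).symm
  | succ m ih =>
    push_cast at ha hb hc
    have ha' : ∀ n : ℕ, a + 1 + m ≠ -n := by simpa [add_assoc, add_comm, add_left_comm] using ha
    have hb' : ∀ n : ℕ, b + 1 + m ≠ -n := by simpa [add_assoc, add_comm, add_left_comm] using hb
    refine .both (ih (a + 1) (b + 1) ha' hb' fun n h => ?_) ha' hb' hc
    refine hc (n + 1) ?_
    push_cast
    linear_combination h

/-! ### Euler's integral as the principal branch -/

section

open Complex MeasureTheory Filter Topology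

theorem Complex.hasSum_one_sub_cpow_neg (a : ℂ) {x : ℂ} (hx : ‖x‖ < 1) :
    HasSum (fun n => poch a n / n.factorial * x ^ n) ((1 - x) ^ (-a)) := by
  have h := (one_div_one_sub_cpow_hasFPowerSeriesOnBall_zero a).hasSum (y := x)
    (by
      rw [← ENNReal.ofReal_one, Metric.eball_ofReal]
      simpa using hx)
  simp only [FormalMultilinearSeries.ofScalars_apply_eq, zero_add, smul_eq_mul] at h
  rw [cpow_neg, ← one_div]
  have e : (fun n => poch a n / n.factorial * x ^ n) =
      fun n : ℕ => Ring.choose (a + n - 1) n * x ^ n := by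
    ext n
    rw [← Ring.multichoose_eq]
    congr 1
    rw [div_eq_iff (factorial_cast_ne_zero n)]
    have := Ring.factorial_nsmul_multichoose_eq_ascPochhammer a n
    rw [Polynomial.ascPochhammer_smeval_eq_eval, nsmul_eq_mul] at this
    rw [poch, ← this, mul_comm]
  rw [e]
  exact h

theorem Gamma_add_nat {a : ℂ} (ha : ∀ n : ℕ, a ≠ -n) (n : ℕ) :
    Gamma (a + n) = poch a n * Gamma a := by
  induction n with
  | zero => simp [poch_zero]
  | succ n ih =>
    rw [Nat.cast_succ, ← add_assoc, Gamma_add_one, ih, poch_succ]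
    · ring
    · simpa using add_nat_ne_neg ha n 0

theorem ne_neg_nat_of_re_pos {a : ℂ} (ha : 0 < a.re) (n : ℕ) : a ≠ -n := by
  rintro rfl
  simp at ha
  linarith [n.cast_nonneg (α := ℝ)]

/-- The weight of Euler's integral. -/
noncomputable def eulerWeight (a b : ℂ) (t : ℝ) : ℂ := (t : ℂ) ^ (b - 1) * (1 - (t : ℂ)) ^ (a - 1)

/-- Euler's integral for the Gauss function with parameters `a, b; a + b`. -/
noncomputable def eulerIntegral (a b z : ℂ) : ℂ :=
  ∫ t : ℝ in (0 : ℝ)..1, eulerWeight a b t * (1 - z * t) ^ (-a)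

theorem one_sub_mul_mem_slitPlane {z : ℂ} (hz : z ∈ cutPlane) {t : ℝ} (h0 : 0 ≤ t) (h1 : t ≤ 1) :
    1 - z * t ∈ slitPlane := by
  have := starConvex_one_slitPlane hz (show 0 ≤ 1 - t by linarith) h0 (by ring)
  convert this using 1
  simp
  ring

theorem intervalIntegrable_eulerWeight {a b : ℂ} (ha : 0 < a.re) (hb : 0 < b.re) :
    IntervalIntegrable (eulerWeight a b) volume 0 1 :=
  betaIntegral_convergent hb ha

theorem continuousOn_one_sub_mul_cpow {z : ℂ} (hz : z ∈ cutPlane) (s : ℂ) :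
    ContinuousOn (fun t : ℝ => (1 - z * t) ^ s) (Set.uIcc 0 1) := by
  refine ContinuousOn.cpow (by fun_prop) (by fun_prop) fun t ht => ?_
  rw [Set.uIcc_of_le zero_le_one] at ht
  exact one_sub_mul_mem_slitPlane hz ht.1 ht.2

theorem differentiableOn_eulerIntegral {a b : ℂ} (ha : 0 < a.re) (hb : 0 < b.re) :
    DifferentiableOn ℂ (eulerIntegral a b) cutPlane := by
  intro z hz
  obtain ⟨r, hr, hball⟩ := Metric.nhds_basis_closedBall.mem_iff.1 (isOpen_cutPlane.mem_nhds hz)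
  -- The z-derivative of the kernel is bounded on this compact set, so a multiple of the integrable
  -- weight dominates the integrand.
  have hcont : ContinuousOn (fun p : ℂ × ℝ => -a * (1 - p.1 * p.2) ^ (-a - 1) * -(p.2 : ℂ))
      (Metric.closedBall z r ×ˢ Set.Icc 0 1) := by
    refine ContinuousOn.mul (ContinuousOn.mul continuousOn_const
      (ContinuousOn.cpow (by fun_prop) (by fun_prop) fun p hp => ?_)) (by fun_prop)
    exact one_sub_mul_mem_slitPlane (hball hp.1) hp.2.1 hp.2.2
  obtain ⟨C, hC⟩ := ((isCompact_closedBall z r).prod isCompact_Icc).exists_bound_of_continuousOn hcont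
  have hw := intervalIntegrable_eulerWeight ha hb
  have hw' := hw.aestronglyMeasurable_restrict_uIoc
  have key := intervalIntegral.hasDerivAt_integral_of_dominated_loc_of_deriv_le
    (μ := volume) (a := 0) (b := 1)
    (F := fun z t => eulerWeight a b t * (1 - z * t) ^ (-a))
    (F' := fun z t => eulerWeight a b t * (-a * (1 - z * t) ^ (-a - 1) * -(t : ℂ)))
    (bound := fun t => ‖eulerWeight a b t‖ * C) (x₀ := z)
    (Metric.closedBall_mem_nhds z hr) ?_ ?_ ?_ ?_ (hw.norm.mul_const C) ?_
  · exact key.2.differentiableAt.differentiableWithinAt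
  · filter_upwards [isOpen_cutPlane.mem_nhds hz] with x hx
    exact (hw.mul_continuousOn (continuousOn_one_sub_mul_cpow hx _)).aestronglyMeasurable_restrict_uIoc
  · exact hw.mul_continuousOn (continuousOn_one_sub_mul_cpow hz _)
  · refine (hw.mul_continuousOn ?_).aestronglyMeasurable_restrict_uIoc
    exact (continuousOn_const.mul (continuousOn_one_sub_mul_cpow hz _)).mul (by fun_prop)
  · refine .of_forall fun t ht x hx => ?_
    rw [Set.uIoc_of_le zero_le_one] at ht
    rw [norm_mul]
    gcongr
    exact hC (x, t) ⟨hx, ht.1.le, ht.2⟩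
  · refine .of_forall fun t ht x hx => ?_
    rw [Set.uIoc_of_le zero_le_one] at ht
    have h1 : HasDerivAt (fun x : ℂ => 1 - x * t) (-(t : ℂ)) x := by
      simpa using ((hasDerivAt_id x).mul_const (t : ℂ)).const_sub 1
    exact (h1.cpow_const (one_sub_mul_mem_slitPlane (hball hx) ht.1.le ht.2)).const_mul _

theorem eulerIntegral_eq_powerSum {a b : ℂ} (ha : 0 < a.re) (hb : 0 < b.re) {z : ℂ}
    (hz : ‖z‖ < 1) :
    eulerIntegral a b z =
      Gamma a * Gamma b / Gamma (a + b) * powerSum (gaussCoeff a b (a + b)) z := by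
  have hw := intervalIntegrable_eulerWeight ha hb
  have hs := (polyGrowth_poch_div_factorial a).summable_norm (norm_nonneg z) hz
  have key : HasSum (fun n : ℕ => ∫ t : ℝ in (0 : ℝ)..1,
      eulerWeight a b t * (poch a n / n.factorial * (z * t) ^ n)) (eulerIntegral a b z) := by
    refine intervalIntegral.hasSum_integral_of_dominated_convergence
      (fun n t => ‖eulerWeight a b t‖ * (‖poch a n / n.factorial‖ * ‖z‖ ^ n)) ?_ ?_ ?_ ?_ ?_
    · intro n
      exact (hw.mul_continuousOn (by fun_prop)).aestronglyMeasurable_restrict_uIoc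
    · refine fun n => .of_forall fun t ht => ?_
      rw [Set.uIoc_of_le zero_le_one] at ht
      rw [norm_mul, norm_mul, norm_pow, norm_mul, norm_real, Real.norm_of_nonneg ht.1.le]
      have ht0 := ht.1.le
      gcongr
      exact mul_le_of_le_one_right (norm_nonneg z) ht.2
    · exact .of_forall fun t _ => hs.mul_left _
    · simp_rw [tsum_mul_left]
      exact hw.norm.mul_const _
    · refine .of_forall fun t ht => ?_
      rw [Set.uIoc_of_le zero_le_one] at ht
      refine (hasSum_one_sub_cpow_neg a ?_).mul_left _
      rw [norm_mul, norm_real, Real.norm_of_nonneg ht.1.le]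
      exact (mul_le_of_le_one_right (norm_nonneg z) ht.2).trans_lt hz
  rw [← key.tsum_eq, powerSum, ← tsum_mul_left]
  refine tsum_congr fun n => ?_
  have hbn : 0 < (b + n).re := by simp; positivity
  have e1 : ∫ t : ℝ in (0 : ℝ)..1, eulerWeight a b t * (poch a n / n.factorial * (z * t) ^ n) =
      poch a n / n.factorial * z ^ n * betaIntegral (b + n) a := by
    rw [betaIntegral, ← intervalIntegral.integral_const_mul]
    refine intervalIntegral.integral_congr_ae (.of_forall fun t ht => ?_)
    rw [Set.uIoc_of_le zero_le_one] at ht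
    have ht0 : (t : ℂ) ≠ 0 := by exact_mod_cast ht.1.ne'
    rw [eulerWeight, show b + n - 1 = b - 1 + n by ring, cpow_add _ _ ht0, cpow_natCast, mul_pow]
    ring
  rw [e1, betaIntegral_eq_Gamma_mul_div _ _ hbn ha, Gamma_add_nat (ne_neg_nat_of_re_pos hb),
    show b + n + a = a + b + n by ring,
    Gamma_add_nat (ne_neg_nat_of_re_pos (show 0 < (a + b).re by simp; positivity)), gaussCoeff]
  simp only [div_eq_mul_inv, mul_inv]
  ring

/-- The symmetry is invisible in the integral but plain in the series. It allows either parameter to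
be reduced to 1 in the limit at z = 1. -/
theorem eulerIntegral_symm {a b : ℂ} (ha : 0 < a.re) (hb : 0 < b.re) {z : ℂ} (hz : ‖z‖ < 1) :
    eulerIntegral a b z = eulerIntegral b a z := by
  rw [eulerIntegral_eq_powerSum ha hb hz, eulerIntegral_eq_powerSum hb ha hz, add_comm b a,
    mul_comm (Gamma b)]
  congr 2
  ext n
  simp only [gaussCoeff, mul_comm (poch b n)]

theorem isGaussPrincipalBranch_eulerIntegral {a b : ℂ} (ha : 0 < a.re) (hb : 0 < b.re) :
    IsGaussPrincipalBranch a b (a + b)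
      (fun z => Gamma (a + b) / (Gamma a * Gamma b) * eulerIntegral a b z) := by
  refine ⟨(differentiableOn_eulerIntegral ha hb).const_mul _, fun z hz => ?_⟩
  simp only
  rw [eulerIntegral_eq_powerSum ha hb hz, ordinaryHypergeometric_eq_powerSum]
  have h1 := Gamma_ne_zero_of_re_pos ha
  have h2 := Gamma_ne_zero_of_re_pos hb
  have h3 := Gamma_ne_zero_of_re_pos (show 0 < (a + b).re by simp; positivity)
  field_simp

/-! ### Behaviour of Euler's integral as z → 1 -/

/-- Gauss's integral for the digamma function, `ψ(1) - ψ(b)`. -/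
noncomputable def gaussIntegral (b : ℂ) : ℂ :=
  ∫ t : ℝ in (0 : ℝ)..1, ((t : ℂ) ^ (b - 1) - 1) * (1 - (t : ℂ)) ^ (-1 : ℂ)

/-- Mean value inequality: Re b ≥ 2 keeps t^(b-2) bounded by 1 on (0,1]. This is the source of the
threshold 2 in the base case. -/
theorem norm_cpow_sub_one_le {b : ℂ} (hb : 2 ≤ b.re ∨ b = 1) {t : ℝ} (h0 : 0 < t) (h1 : t ≤ 1) :
    ‖(t : ℂ) ^ (b - 1) - 1‖ ≤ ‖b - 1‖ * (1 - t) := by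
  rcases hb with hb | rfl
  · have hd : ∀ x ∈ Set.Ioc (0 : ℝ) 1, HasDerivWithinAt (fun x : ℝ => (x : ℂ) ^ (b - 1))
        ((b - 1) * (x : ℂ) ^ (b - 1 - 1)) (Set.Ioc 0 1) x := by
      intro x hx
      refine HasDerivAt.hasDerivWithinAt ?_
      have := (hasDerivAt_id (x : ℂ)).cpow_const (c := b - 1) (ofReal_mem_slitPlane.2 hx.1)
      simpa using this.comp_ofReal
    have := (convex_Ioc (0 : ℝ) 1).norm_image_sub_le_of_norm_hasDerivWithin_le (C := ‖b - 1‖) hd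
      (fun x hx => ?_) (x := 1) (y := t) (by simp) ⟨h0, h1⟩
    · simpa [abs_of_nonpos (sub_nonpos.2 h1)] using this
    · rw [norm_mul, norm_cpow_eq_rpow_re_of_pos hx.1]
      refine mul_le_of_le_one_right (norm_nonneg _) (Real.rpow_le_one hx.1.le hx.2 ?_)
      simp
      linarith
  · simp

/-- Dominated convergence: the zero of t^(b-1) - 1 at t = 1 cancels the bound 1/(1-t) on the kernel.
One family of kernels evaluates Gauss's integral, another gives the limit of Euler's integral. -/
theorem tendsto_integral_cpow_sub_one {ι : Type*} {l : Filter ι} [l.IsCountablyGenerated]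
    {b : ℂ} (hb : 2 ≤ b.re ∨ b = 1) {k : ι → ℝ → ℂ}
    (hk : ∀ᶠ i in l, ContinuousOn (k i) (Set.Ioo 0 1))
    (hk' : ∀ᶠ i in l, ∀ t ∈ Set.Ioo (0 : ℝ) 1, ‖k i t‖ ≤ (1 - t)⁻¹)
    (hlim : ∀ t ∈ Set.Ioo (0 : ℝ) 1, Tendsto (fun i => k i t) l (𝓝 ((1 - (t : ℂ)) ^ (-1 : ℂ)))) :
    Tendsto (fun i => ∫ t : ℝ in (0 : ℝ)..1, ((t : ℂ) ^ (b - 1) - 1) * k i t) l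
      (𝓝 (gaussIntegral b)) := by
  have hrestr : volume.restrict (Set.uIoc (0 : ℝ) 1) = volume.restrict (Set.Ioo 0 1) := by
    rw [Set.uIoc_of_le zero_le_one, restrict_Ioo_eq_restrict_Ioc]
  have hne : ∀ᵐ t : ℝ, t ≠ 1 := by simp [ae_iff]
  refine intervalIntegral.tendsto_integral_filter_of_dominated_convergence
    (fun _ => ‖b - 1‖) ?_ ?_ (by simp) ?_
  · filter_upwards [hk] with i hi
    rw [hrestr]
    refine ContinuousOn.aestronglyMeasurable (ContinuousOn.mul ?_ hi) measurableSet_Ioo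
    refine ContinuousOn.sub (ContinuousOn.cpow (by fun_prop) (by fun_prop) fun t ht => ?_)
      continuousOn_const
    exact ofReal_mem_slitPlane.2 ht.1
  · filter_upwards [hk'] with i hi
    filter_upwards [hne] with t ht1 ht
    rw [Set.uIoc_of_le zero_le_one] at ht
    have hlt := lt_of_le_of_ne ht.2 ht1
    rw [norm_mul]
    calc _ ≤ (‖b - 1‖ * (1 - t)) * (1 - t)⁻¹ := by
          refine mul_le_mul (norm_cpow_sub_one_le hb ht.1 ht.2) (hi t ⟨ht.1, hlt⟩)
            (norm_nonneg _) (mul_nonneg (norm_nonneg _) (by linarith))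
      _ = _ := by
          rw [mul_assoc, mul_inv_cancel₀ (by linarith), mul_one]
  · filter_upwards [hne] with t ht1 ht
    rw [Set.uIoc_of_le zero_le_one] at ht
    exact (hlim t ⟨ht.1, lt_of_le_of_ne ht.2 ht1⟩).const_mul _

/-- The integral is the limit of B(b,ε) - B(1,ε) as ε → 0+. Since Γ(ε) = Γ(1+ε)/ε, this is Γ(1+ε)
times a difference quotient of Γ(b)/Γ(b+ε) - Γ(1)/Γ(1+ε), whose derivative at 0 is ψ(1) - ψ(b). -/
theorem gaussIntegral_eq {b : ℂ} (hb : 2 ≤ b.re ∨ b = 1) :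
    gaussIntegral b = digamma 1 - digamma b := by
  have hb0 : 0 < b.re := by
    rcases hb with hb | rfl
    · linarith
    · simp
  have lim1 : Tendsto (fun ε : ℝ => betaIntegral b ε - betaIntegral 1 ε) (𝓝[>] 0)
      (𝓝 (gaussIntegral b)) := by
    refine (tendsto_integral_cpow_sub_one (l := 𝓝[>] (0 : ℝ))
      (k := fun ε t => (1 - (t : ℂ)) ^ ((ε : ℂ) - 1)) hb ?_ ?_ ?_).congr' ?_
    · refine .of_forall fun ε => ContinuousOn.cpow (by fun_prop) (by fun_prop) fun t ht => ?_
      exact_mod_cast ofReal_mem_slitPlane.2 (sub_pos.2 ht.2)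
    · filter_upwards [self_mem_nhdsWithin] with ε hε t ht
      have h1 : (0 : ℝ) < 1 - t := sub_pos.2 ht.2
      rw [← Real.rpow_neg_one, ← ofReal_one, ← ofReal_sub, norm_cpow_eq_rpow_re_of_pos h1]
      refine Real.rpow_le_rpow_of_exponent_ge h1 (by linarith [ht.1]) ?_
      have : 0 < ε := hε
      simp
      linarith
    · intro t ht
      have h1 : (1 - (t : ℂ)) ≠ 0 := by exact_mod_cast (sub_pos.2 ht.2).ne'
      have : ContinuousAt (fun ε : ℝ => (1 - (t : ℂ)) ^ ((ε : ℂ) - 1)) 0 :=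
        ContinuousAt.const_cpow (by fun_prop) (.inl h1)
      simpa using this.tendsto.mono_left nhdsWithin_le_nhds
    · filter_upwards [self_mem_nhdsWithin] with ε hε
      have hε : 0 < (ε : ℂ).re := by simpa using hε
      rw [betaIntegral, betaIntegral, ← intervalIntegral.integral_sub
        (betaIntegral_convergent hb0 hε) (betaIntegral_convergent (by simp) hε)]
      congr 1
      ext t
      simp
      ring
  have hd : ∀ c : ℂ, 0 < c.re → HasDerivAt (fun ε : ℝ => Gamma c / Gamma (c + ε))
      (-digamma c) 0 := by
    intro c hc
    have hG := Gamma_ne_zero_of_re_pos hc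
    have h1 : HasDerivAt Gamma (deriv Gamma c) (c + 0) := by
      rw [add_zero]
      exact (differentiableAt_Gamma c (ne_neg_nat_of_re_pos hc)).hasDerivAt
    have h2 : HasDerivAt (fun x : ℂ => Gamma (c + x)) (deriv Gamma c) 0 :=
      h1.comp_const_add c 0
    have h3 := ((hasDerivAt_const (0 : ℂ) (Gamma c)).div h2 (by simpa using hG))
    have h4 := HasDerivAt.comp_ofReal (z := 0) (by simpa using h3)
    refine h4.congr_deriv ?_
    rw [digamma_def, logDeriv_apply]
    field_simp
  have h1 : (0 : ℝ) < (1 : ℂ).re := by simp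
  have lim2 : Tendsto (fun ε : ℝ => betaIntegral b ε - betaIntegral 1 ε) (𝓝[>] 0)
      (𝓝 (Gamma ((0 : ℝ) + 1) * (-digamma b - -digamma 1))) := by
    have hs := (hasDerivAt_iff_tendsto_slope_zero.1 ((hd b hb0).sub (hd 1 h1))).mono_left
      (nhdsGT_le_nhdsNE (0 : ℝ))
    have hG : Tendsto (fun ε : ℝ => Gamma (ε + 1)) (𝓝[>] 0) (𝓝 (Gamma ((0 : ℝ) + 1))) := by
      have : ContinuousAt (fun ε : ℝ => Gamma ((ε : ℂ) + 1)) 0 := by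
        refine ContinuousAt.comp (g := Gamma) ?_ (by fun_prop)
        exact (differentiableAt_Gamma _ (ne_neg_nat_of_re_pos (by simp))).continuousAt
      exact this.tendsto.mono_left nhdsWithin_le_nhds
    refine (hG.mul hs).congr' ?_
    filter_upwards [self_mem_nhdsWithin] with ε hε
    have hε' : 0 < (ε : ℂ).re := by simpa using hε
    have hε0 : (ε : ℂ) ≠ 0 := by
      rintro h
      simp [h] at hε'
    rw [betaIntegral_eq_Gamma_mul_div _ _ hb0 hε', betaIntegral_eq_Gamma_mul_div _ _ h1 hε',
      Gamma_add_one _ hε0]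
    have e1 := div_self (Gamma_ne_zero_of_re_pos hb0)
    have e2 := div_self (Gamma_ne_zero_of_re_pos h1)
    simp only [Pi.sub_apply, zero_add, ofReal_zero, add_zero, e1, e2, sub_self, sub_zero,
      real_smul, ofReal_inv]
    field_simp
  have := tendsto_nhds_unique lim1 lim2
  simp at this
  rw [this]
  ring

theorem tendsto_eulerIntegral_sub {a b : ℂ} (ha : 0 < a.re) (hb : 2 ≤ b.re ∨ b = 1) :
    Tendsto (fun w : ℝ => eulerIntegral a b (1 - w) - eulerIntegral a 1 (1 - w)) (𝓝[>] 0)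
      (𝓝 (digamma 1 - digamma b)) := by
  have hb0 : 0 < b.re := by
    rcases hb with hb | rfl
    · linarith
    · simp
  rw [← gaussIntegral_eq hb]
  have hmem : ∀ w : ℝ, 0 < w → ∀ t ∈ Set.Ioo (0 : ℝ) 1, 1 - t ≤ 1 - (1 - w) * t := by
    intro w hw t ht
    nlinarith [ht.1]
  refine (tendsto_integral_cpow_sub_one (l := 𝓝[>] (0 : ℝ))
    (k := fun w t => (1 - (t : ℂ)) ^ (a - 1) * (1 - (1 - (w : ℂ)) * t) ^ (-a)) hb ?_ ?_ ?_).congr' ?_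
  · filter_upwards [self_mem_nhdsWithin] with w hw
    refine ContinuousOn.mul (ContinuousOn.cpow (by fun_prop) (by fun_prop) fun t ht => ?_)
      (ContinuousOn.cpow (by fun_prop) (by fun_prop) fun t ht => ?_)
    · exact_mod_cast ofReal_mem_slitPlane.2 (sub_pos.2 ht.2)
    · exact_mod_cast ofReal_mem_slitPlane.2 ((sub_pos.2 ht.2).trans_le (hmem w hw t ht))
  · filter_upwards [self_mem_nhdsWithin] with w hw t ht
    have h1 : (0 : ℝ) < 1 - t := sub_pos.2 ht.2
    have h2 := hmem w hw t ht
    have e1 : (1 - (t : ℂ)) = ((1 - t : ℝ) : ℂ) := by push_cast; ring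
    have e2 : (1 - (1 - (w : ℂ)) * t) = ((1 - (1 - w) * t : ℝ) : ℂ) := by push_cast; ring
    rw [norm_mul, e1, e2, norm_cpow_eq_rpow_re_of_pos h1,
      norm_cpow_eq_rpow_re_of_pos (h1.trans_le h2)]
    have h3 : (-a).re ≤ 0 := by
      rw [neg_re]
      linarith
    calc (1 - t) ^ (a - 1).re * (1 - (1 - w) * t) ^ (-a).re
        ≤ (1 - t) ^ (a - 1).re * (1 - t) ^ (-a).re := by
          exact mul_le_mul_of_nonneg_left (Real.rpow_le_rpow_of_nonpos h1 h2 h3)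
            (Real.rpow_nonneg h1.le _)
      _ = (1 - t)⁻¹ := by
          rw [← Real.rpow_add h1, ← Real.rpow_neg_one]
          congr 1
          simp
          ring
  · intro t ht
    have h1 : (1 - (t : ℂ)) ≠ 0 := by exact_mod_cast (sub_pos.2 ht.2).ne'
    have : ContinuousAt
        (fun w : ℝ => (1 - (t : ℂ)) ^ (a - 1) * (1 - (1 - (w : ℂ)) * t) ^ (-a)) 0 := by
      refine ContinuousAt.mul continuousAt_const (ContinuousAt.cpow (by fun_prop) (by fun_prop) ?_)
      simpa using ofReal_mem_slitPlane.2 (sub_pos.2 ht.2)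
    have e : (1 - (t : ℂ)) ^ (-1 : ℂ) =
        (1 - (t : ℂ)) ^ (a - 1) * (1 - (1 - ((0 : ℝ) : ℂ)) * t) ^ (-a) := by
      rw [ofReal_zero, sub_zero, one_mul, ← cpow_add _ _ h1]
      congr 1
      ring
    rw [e]
    exact this.tendsto.mono_left nhdsWithin_le_nhds
  · filter_upwards [self_mem_nhdsWithin] with w hw
    have hw' : (1 - (w : ℂ)) ∈ cutPlane := one_sub_mem_cutPlane (ofReal_mem_slitPlane.2 hw)
    have hc := continuousOn_one_sub_mul_cpow hw' (-a)
    rw [eulerIntegral, eulerIntegral, ← intervalIntegral.integral_sub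
      ((intervalIntegrable_eulerWeight ha hb0).mul_continuousOn hc)
      ((intervalIntegrable_eulerWeight ha (by simp)).mul_continuousOn hc)]
    congr 1
    ext t
    simp [eulerWeight]
    ring

theorem mul_eulerIntegral_one_one {z : ℂ} (hz : ‖z‖ < 1) :
    z * eulerIntegral 1 1 z = -log (1 - z) := by
  rw [eulerIntegral_eq_powerSum (by simp) (by simp) hz, ← powerSum_const_mul,
    mul_powerSum (u := fun n => (n : ℂ)⁻¹) _ (by simp) _ hz, powerSum,
    ← (hasSum_taylorSeries_neg_log hz).tsum_eq]
  · exact tsum_congr fun n => by ring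
  · refine .of_succ (u := fun n => (n : ℂ)⁻¹)
      (.of_inv_recurrence (u := fun n : ℕ => ((n + 1 : ℕ) : ℂ)⁻¹) 2 fun n => ?_)
    have := cast_succ_ne_zero n
    have h2 : (2 : ℂ) + n ≠ 0 := by exact_mod_cast (show 2 + n ≠ 0 by omega)
    have h3 : (n : ℂ) + 1 + 1 ≠ 0 := by exact_mod_cast (show n + 1 + 1 ≠ 0 by omega)
    push_cast
    field_simp
    ring
  · intro n
    have h2 : poch (1 + 1) n = (n + 1).factorial := by
      rw [← poch_one, poch_succ_left, one_mul]
    have := factorial_cast_ne_zero n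
    have := cast_succ_ne_zero n
    have hG := Gamma_add_one (1 : ℂ) one_ne_zero
    rw [hG, gaussCoeff, h2, poch_one, Nat.factorial_succ]
    simp
    field_simp

theorem tendsto_eulerIntegral_one_one_add_log :
    Tendsto (fun w : ℝ => eulerIntegral 1 1 (1 - w) + log w) (𝓝[>] 0) (𝓝 0) := by
  have h0 : Tendsto (fun w : ℝ => Real.log w * w) (𝓝[>] 0) (𝓝 0) := by
    simpa using tendsto_log_mul_rpow_nhdsGT_zero zero_lt_one
  have h1 : Tendsto (fun w : ℝ => ((Real.log w * w / (1 - w) : ℝ) : ℂ)) (𝓝[>] 0) (𝓝 0) := by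
    have h : Tendsto (fun w : ℝ => Real.log w * w / (1 - w)) (𝓝[>] 0) (𝓝 (0 / (1 - 0))) :=
      h0.div
        ((by fun_prop : Continuous fun w : ℝ => 1 - w).tendsto 0 |>.mono_left nhdsWithin_le_nhds)
        (by simp)
    rw [zero_div] at h
    exact_mod_cast (continuous_ofReal.tendsto 0).comp h
  have h2 := h1.neg
  rw [neg_zero] at h2
  refine h2.congr' ?_
  filter_upwards [Ioo_mem_nhdsGT one_pos] with w hw
  have hn : ‖(1 - (w : ℂ))‖ < 1 := by
    rw [← ofReal_one, ← ofReal_sub, norm_real, Real.norm_of_nonneg (by linarith [hw.2])]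
    linarith [hw.1]
  have e := mul_eulerIntegral_one_one hn
  have h0 : (1 - (w : ℂ)) ≠ 0 := by exact_mod_cast (sub_pos.2 hw.2).ne'
  rw [sub_sub_cancel] at e
  push_cast
  rw [ofReal_log hw.1.le, ← mul_right_inj' h0, mul_add, e]
  field_simp
  ring

/-- Replace b by 1, swap, replace a by 1; what remains is the elementary I(1,1;z) = -log(1-z)/z. -/
theorem tendsto_eulerIntegral_add_log {a b : ℂ} (ha : 2 ≤ a.re) (hb : 2 ≤ b.re) :
    Tendsto (fun w : ℝ => eulerIntegral a b (1 - w) + log w) (𝓝[>] 0)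
      (𝓝 (2 * digamma 1 - digamma a - digamma b)) := by
  have h := ((tendsto_eulerIntegral_sub (a := a) (by linarith) (.inl hb)).add
    (tendsto_eulerIntegral_sub (a := 1) (by simp) (.inl ha))).add
    tendsto_eulerIntegral_one_one_add_log
  have e : digamma 1 - digamma b + (digamma 1 - digamma a) + 0 =
    2 * digamma 1 - digamma a - digamma b := by ring
  rw [e] at h
  refine h.congr' ?_
  filter_upwards [Ioo_mem_nhdsGT one_pos] with w hw
  have hn : ‖(1 - (w : ℂ))‖ < 1 := by
    rw [← ofReal_one, ← ofReal_sub, norm_real, Real.norm_of_nonneg (by linarith [hw.2])]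
    linarith [hw.1]
  rw [eulerIntegral_symm (a := a) (b := 1) (by linarith) (by simp) hn]
  ring

/-! ### Wronskian and uniqueness for the hypergeometric equation -/

/-- The intersection of the unit discs about `0` and `1`. -/
def lens : Set ℂ := Metric.ball 0 1 ∩ Metric.ball 1 1

theorem isOpen_lens : IsOpen lens := Metric.isOpen_ball.inter Metric.isOpen_ball

theorem convex_lens : Convex ℝ lens := (convex_ball _ _).inter (convex_ball _ _)

theorem norm_lt_one_of_mem_lens {w : ℂ} (hw : w ∈ lens) : ‖w‖ < 1 := by simpa using hw.1

theorem norm_one_sub_lt_one_of_mem_lens {w : ℂ} (hw : w ∈ lens) : ‖1 - w‖ < 1 := by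
  simpa [dist_eq_norm, norm_sub_rev] using hw.2

theorem mem_slitPlane_of_mem_lens {w : ℂ} (hw : w ∈ lens) : w ∈ slitPlane := by
  simpa [cutPlane] using mem_cutPlane_of_norm_lt_one (norm_one_sub_lt_one_of_mem_lens hw)

theorem ofReal_mem_lens {x : ℝ} (h0 : 0 < x) (h1 : x < 1) : (x : ℂ) ∈ lens := by
  constructor
  · simpa [abs_of_pos h0] using h1
  · rw [Metric.mem_ball, dist_eq_norm, ← ofReal_one, ← ofReal_sub, norm_real, Real.norm_eq_abs,
      abs_lt]
    constructor <;> linarith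

theorem gaussCoeff_one_ode (a b : ℂ) {w : ℂ} (hw : ‖w‖ < 1) :
    w * (1 - w) * powerSum (derivCoeff (derivCoeff (gaussCoeff a b 1))) w +
        (1 - (a + b + 1) * w) * powerSum (derivCoeff (gaussCoeff a b 1)) w -
        a * b * powerSum (gaussCoeff a b 1) w = 0 := by
  rw [powerSum_hypergeometric (polyGrowth_gaussCoeff a b 1) a b 1 hw, powerSum]
  refine (tsum_congr fun n => ?_).trans tsum_zero
  have := gaussCoeff_succ a b 1 n (ne_neg_nat_of_re_pos (by simp))
  linear_combination w ^ n * this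

/-- The Wronskian of the hypergeometric equation with parameters `a, b; 1`. -/
theorem exists_wronskian_eq {a b : ℂ} {y y₁ y₂ : ℂ → ℂ}
    (h1 : ∀ w ∈ lens, HasDerivAt y (y₁ w) w) (h2 : ∀ w ∈ lens, HasDerivAt y₁ (y₂ w) w)
    (hode : ∀ w ∈ lens, w * (1 - w) * y₂ w + (1 - (a + b + 1) * w) * y₁ w - a * b * y w = 0) :
    ∃ K : ℂ, ∀ w ∈ lens, w * (1 - w) ^ (a + b) * (powerSum (gaussCoeff a b 1) w * y₁ w -
      powerSum (derivCoeff (gaussCoeff a b 1)) w * y w) = K := by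
  have hq := polyGrowth_gaussCoeff a b 1
  have hder : ∀ w ∈ lens, HasDerivAt (fun w => w * (1 - w) ^ (a + b) *
      (powerSum (gaussCoeff a b 1) w * y₁ w -
        powerSum (derivCoeff (gaussCoeff a b 1)) w * y w)) 0 w := by
    intro w hw
    have hw1 := norm_lt_one_of_mem_lens hw
    have hs : 1 - w ∈ slitPlane := mem_cutPlane_of_norm_lt_one hw1
    have hs0 : 1 - w ≠ 0 := slitPlane_ne_zero hs
    have hp : HasDerivAt (fun w : ℂ => (1 - w) ^ (a + b)) ((a + b) * (1 - w) ^ (a + b - 1) * -1) w :=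
      ((hasDerivAt_id w).const_sub 1).cpow_const hs
    have hW := ((hq.hasDerivAt hw1).mul (h2 w hw)).sub ((hq.derivCoeff.hasDerivAt hw1).mul (h1 w hw))
    have := ((hasDerivAt_id w).mul hp).mul hW
    refine this.congr_deriv ?_
    have e1 := hode w hw
    have e2 := gaussCoeff_one_ode a b hw1
    have e3 : (1 - w) ^ (a + b) = (1 - w) ^ (a + b - 1) * (1 - w) := by
      rw [cpow_sub _ _ hs0, cpow_one, div_mul_cancel₀ _ hs0]
    simp only [Pi.mul_apply, Pi.sub_apply, id]
    rw [e3]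
    linear_combination (1 - w) ^ (a + b - 1) * (powerSum (gaussCoeff a b 1) w * e1 - y w * e2)
  exact isOpen_lens.exists_is_const_of_deriv_eq_zero convex_lens.isPreconnected
    (fun w hw => (hder w hw).differentiableAt.differentiableWithinAt) fun w hw => (hder w hw).deriv

/-- The Wronskian gives (y/φ)' = K / (w (1-w)^(a+b) φ²) with φ(0) = 1, so y/φ - K log w has bounded
derivative near 0. As y → 0 while log w is unbounded, K = 0; then y/φ is constant with limit 0. -/
theorem eventually_eq_zero_of_ode {a b : ℂ} {y y₁ y₂ : ℂ → ℂ}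
    (h1 : ∀ w ∈ lens, HasDerivAt y (y₁ w) w) (h2 : ∀ w ∈ lens, HasDerivAt y₁ (y₂ w) w)
    (hode : ∀ w ∈ lens, w * (1 - w) * y₂ w + (1 - (a + b + 1) * w) * y₁ w - a * b * y w = 0)
    (hlim : Tendsto (fun x : ℝ => y x) (𝓝[>] 0) (𝓝 0)) :
    ∃ δ > 0, δ < 1 ∧ ∀ x ∈ Set.Ioo (0 : ℝ) δ, y x = 0 := by
  obtain ⟨K, hK⟩ := exists_wronskian_eq h1 h2 hode
  have hq := polyGrowth_gaussCoeff a b 1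
  set φ := powerSum (gaussCoeff a b 1) with hφ
  have hφ0 : φ 0 = 1 := by rw [hφ, powerSum_zero, gaussCoeff_zero]
  have hφd := hq.hasDerivAt (z := 0) (by simp)
  have hg : DifferentiableAt ℂ (fun w : ℂ => ((1 - w) ^ (a + b) * φ w ^ 2)⁻¹) 0 := by
    refine DifferentiableAt.inv (DifferentiableAt.mul ?_ (hφd.differentiableAt.pow 2)) ?_
    · exact DifferentiableAt.cpow_const (by fun_prop) (by simp)
    · simp [hφ0]
  -- `C` bounds the difference quotient of 1/((1-w)^(a+b) φ²) at 0, where its value is 1.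
  have hO := hg.hasDerivAt.isBigO_sub
  obtain ⟨C, hC⟩ := hO.bound
  have hφne : ∀ᶠ w in 𝓝 (0 : ℂ), φ w ≠ 0 :=
    hφd.continuousAt.eventually_ne (by rw [← hφ, hφ0]; exact one_ne_zero)
  obtain ⟨ε, hε, hball⟩ := Metric.eventually_nhds_iff_ball.1 (hC.and hφne)
  set δ := min ε (1 / 2) with hδ
  have hδ0 : 0 < δ := by positivity
  have hδ1 : δ < 1 := (min_le_right _ _).trans_lt (by norm_num)
  have hmem : ∀ x ∈ Set.Ioo (0 : ℝ) δ, (x : ℂ) ∈ lens ∧ (x : ℂ) ∈ Metric.ball (0 : ℂ) ε := by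
    intro x hx
    refine ⟨ofReal_mem_lens hx.1 (hx.2.trans hδ1), ?_⟩
    simpa [abs_of_pos hx.1] using hx.2.trans_le (min_le_left _ _)
  have hder : ∀ x ∈ Set.Ioo (0 : ℝ) δ, HasDerivWithinAt (fun x : ℝ => y x / φ x - K * log x)
      (K * (((1 - (x : ℂ)) ^ (a + b) * φ x ^ 2)⁻¹ - 1) / x) (Set.Ioo 0 δ) x := by
    intro x hx
    obtain ⟨hl, hb⟩ := hmem x hx
    have hn := (hball _ hb).2
    have hx1 := norm_lt_one_of_mem_lens hl
    have hs := mem_slitPlane_of_mem_lens hl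
    have hd := ((h1 _ hl).div (hq.hasDerivAt hx1) hn).sub ((hasDerivAt_log hs).const_mul K)
    refine (hd.comp_ofReal.congr_deriv ?_).hasDerivWithinAt
    have e := hK _ hl
    have hx0 := slitPlane_ne_zero hs
    have hp : (1 - (x : ℂ)) ^ (a + b) ≠ 0 := by
      rw [cpow_ne_zero_iff]
      exact .inl (slitPlane_ne_zero (mem_cutPlane_of_norm_lt_one hx1))
    rw [← e, ← hφ]
    field_simp
  have hbound : ∀ x ∈ Set.Ioo (0 : ℝ) δ,
      ‖K * (((1 - (x : ℂ)) ^ (a + b) * φ x ^ 2)⁻¹ - 1) / x‖ ≤ ‖K‖ * C := by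
    intro x hx
    obtain ⟨hl, hb⟩ := hmem x hx
    have hc := (hball _ hb).1
    simp only [sub_zero, one_cpow, hφ0, one_pow, mul_one, inv_one] at hc
    have hx0 : 0 < ‖(x : ℂ)‖ := norm_pos_iff.2 (slitPlane_ne_zero (mem_slitPlane_of_mem_lens hl))
    rw [norm_div, norm_mul, div_le_iff₀ hx0, mul_assoc]
    gcongr
  have hlip : ∀ x ∈ Set.Ioo (0 : ℝ) δ, ∀ x' ∈ Set.Ioo (0 : ℝ) δ,
      ‖(y x' / φ x' - K * log x') - (y x / φ x - K * log x)‖ ≤ ‖K‖ * C * ‖x' - x‖ :=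
    fun x hx x' hx' => (convex_Ioo 0 δ).norm_image_sub_le_of_norm_hasDerivWithin_le hder hbound hx hx'
  have hr : Tendsto (fun x : ℝ => y x / φ x) (𝓝[>] 0) (𝓝 0) := by
    have hφt : Tendsto (fun x : ℝ => φ x) (𝓝[>] 0) (𝓝 1) := by
      have : ContinuousAt (fun x : ℝ => φ x) 0 :=
        ContinuousAt.comp (g := φ) (by simpa using hφd.continuousAt) (by fun_prop)
      simpa [hφ0] using this.tendsto.mono_left nhdsWithin_le_nhds
    have h := hlim.div hφt one_ne_zero
    rw [zero_div] at h
    exact h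
  have hIoo : Set.Ioo (0 : ℝ) δ ∈ 𝓝[>] (0 : ℝ) := Ioo_mem_nhdsGT hδ0
  have hhalf : δ / 2 ∈ Set.Ioo (0 : ℝ) δ := ⟨by positivity, by linarith⟩
  have hK0 : K = 0 := by
    by_contra hne
    have hlog : Tendsto (fun x : ℝ => ‖K‖ * ‖Real.log x‖) (𝓝[>] 0) atTop :=
      (tendsto_abs_atBot_atTop.comp Real.tendsto_log_nhdsGT_zero).const_mul_atTop
        (norm_pos_iff.2 hne)
    -- The threshold adds bounds for y/φ, for the value at δ/2, and for the variation between the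
    -- two points, which are at distance at most 1.
    have hb := hlog.eventually_gt_atTop
      (1 + ‖y (δ / 2 : ℝ) / φ (δ / 2 : ℝ) - K * log (δ / 2 : ℝ)‖ + ‖K‖ * |C|)
    have hr1 := hr.norm.eventually_lt_const (show ‖(0 : ℂ)‖ < 1 by simp)
    obtain ⟨x, hx, hx2, hx3⟩ := (hb.and (hr1.and hIoo)).exists
    have h := hlip _ hhalf x hx3
    have hlt : ‖x - δ / 2‖ ≤ 1 := by
      rw [Real.norm_eq_abs, abs_le]
      constructor <;> linarith [hx3.1, hx3.2]
    have hle : ‖K‖ * C * ‖x - δ / 2‖ ≤ ‖K‖ * |C| := by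
      calc ‖K‖ * C * ‖x - δ / 2‖ ≤ ‖K‖ * |C| * ‖x - δ / 2‖ := by gcongr; exact le_abs_self C
        _ ≤ ‖K‖ * |C| * 1 := by gcongr
        _ = _ := mul_one _
    have e : K * log (x : ℂ) = y x / φ x - (y (δ / 2 : ℝ) / φ (δ / 2 : ℝ) - K * log (δ / 2 : ℝ)) -
      ((y x / φ x - K * log x) - (y (δ / 2 : ℝ) / φ (δ / 2 : ℝ) - K * log (δ / 2 : ℝ))) := by ring
    have e2 : ‖K‖ * ‖Real.log x‖ = ‖K * log (x : ℂ)‖ := by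
      rw [norm_mul, ← ofReal_log hx3.1.le, norm_real]
    rw [e2, e] at hx
    have t1 := norm_sub_le (y x / φ x - (y (δ / 2 : ℝ) / φ (δ / 2 : ℝ) - K * log (δ / 2 : ℝ)))
      ((y x / φ x - K * log x) - (y (δ / 2 : ℝ) / φ (δ / 2 : ℝ) - K * log (δ / 2 : ℝ)))
    have t2 := norm_sub_le (y x / φ x) (y (δ / 2 : ℝ) / φ (δ / 2 : ℝ) - K * log (δ / 2 : ℝ))
    linarith
  refine ⟨δ, hδ0, hδ1, fun x hx => ?_⟩
  have hconst : ∀ x' ∈ Set.Ioo (0 : ℝ) δ, y x' / φ x' = y x / φ x := by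
    intro x' hx'
    have := hlip x hx x' hx'
    rw [hK0] at this
    simpa [sub_eq_zero] using this
  have hz : y x / φ x = 0 := by
    refine tendsto_nhds_unique (tendsto_const_nhds.congr' ?_) hr
    filter_upwards [hIoo] with x' hx' using (hconst x' hx').symm
  exact (div_eq_zero_iff.1 hz).resolve_right (hball _ (hmem x hx).2).2

/-! ### The base case of the expansion -/

theorem logCoeff_zero_eq (a b : ℂ) (n : ℕ) : logCoeff a b 0 n = -gaussCoeff a b 1 n := by
  simp [logCoeff, gaussCoeff, poch_one]
  ring

/-- The inhomogeneous hypergeometric equation of the part free of logarithms. -/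
theorem regCoeff_zero_ode {a b : ℂ} (ha : ∀ n : ℕ, a ≠ -n) (hb : ∀ n : ℕ, b ≠ -n) {w : ℂ}
    (hw : ‖w‖ < 1) :
    w * (1 - w) * powerSum (derivCoeff (derivCoeff (regCoeff a b 0))) w +
        (1 - (a + b + 1) * w) * powerSum (derivCoeff (regCoeff a b 0)) w -
        a * b * powerSum (regCoeff a b 0) w =
      2 * (1 - w) * powerSum (derivCoeff (gaussCoeff a b 1)) w -
        (a + b) * powerSum (gaussCoeff a b 1) w := by
  have hq := polyGrowth_gaussCoeff a b 1
  have e1 := mul_powerSum_derivCoeff hq hw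
  have e2 : 2 * (1 - w) * powerSum (derivCoeff (gaussCoeff a b 1)) w -
      (a + b) * powerSum (gaussCoeff a b 1) w = powerSum (fun n => 2 * derivCoeff (gaussCoeff a b 1) n -
        (2 * (n * gaussCoeff a b 1 n) + (a + b) * gaussCoeff a b 1 n)) w := by
    rw [powerSum_sub (hq.derivCoeff.const_mul 2)
      (((PolyGrowth.natCast.mul hq).const_mul 2).add (hq.const_mul _)) hw,
      powerSum_add ((PolyGrowth.natCast.mul hq).const_mul 2) (hq.const_mul _) hw,
      powerSum_const_mul, powerSum_const_mul, powerSum_const_mul, ← e1]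
    ring
  rw [powerSum_hypergeometric
    (polyGrowth_regCoeff 0 (by simpa using ha) (by simpa using hb)) a b 1 hw, e2]
  congr 1
  ext n
  have ha' := digamma_apply_add_one (a + n) (add_nat_ne_neg ha n)
  have hb' := digamma_apply_add_one (b + n) (add_nat_ne_neg hb n)
  have ha0 : a + n ≠ 0 := by simpa using add_nat_ne_neg ha n 0
  have hb0 : b + n ≠ 0 := by simpa using add_nat_ne_neg hb n 0
  have hn := digamma_nat_add_one n
  have hn1 := cast_succ_ne_zero n
  have hs : gaussCoeff a b 1 (n + 1) =
      (a + n) * (b + n) / ((n + 1) * (n + 1)) * gaussCoeff a b 1 n := by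
    have := gaussCoeff_succ a b 1 n (ne_neg_nat_of_re_pos (by simp))
    field_simp
    linear_combination this
  simp only [regCoeff, Nat.not_lt_zero, if_false, Nat.sub_zero, logCoeff_zero_eq, derivCoeff]
  push_cast
  rw [hn, ← add_assoc a, ← add_assoc b, ha', hb', hs]
  field_simp
  ring

theorem tendsto_powerSum_ofReal {u : ℕ → ℂ} (hu : PolyGrowth u) :
    Tendsto (fun x : ℝ => powerSum u x) (𝓝[>] 0) (𝓝 (u 0)) := by
  have h1 : ContinuousAt (powerSum u) ((0 : ℝ) : ℂ) := by
    simpa using (hu.hasDerivAt (z := 0) (by simp)).continuousAt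
  have : ContinuousAt (fun x : ℝ => powerSum u x) 0 :=
    ContinuousAt.comp (g := powerSum u) h1 (by fun_prop)
  have h := this.tendsto.mono_left (nhdsWithin_le_nhds (s := Set.Ioi 0))
  rwa [ofReal_zero, powerSum_zero] at h

/-- The leading logarithmic coefficient is -1, so log w cancels and the remaining logarithmic part
is O(w log w). -/
theorem tendsto_expansion_sub_log {a b : ℂ} (ha : ∀ n : ℕ, a ≠ -n) (hb : ∀ n : ℕ, b ≠ -n) :
    Tendsto (fun x : ℝ => powerSum (regCoeff a b 0) x + log x * powerSum (logCoeff a b 0) x + log x)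
      (𝓝[>] 0) (𝓝 (2 * digamma 1 - digamma a - digamma b)) := by
  have hlog := polyGrowth_logCoeff a b 0
  have h1 := tendsto_powerSum_ofReal
    (polyGrowth_regCoeff (a := a) (b := b) 0 (by simpa using ha) (by simpa using hb))
  have h2 : Tendsto (fun x : ℝ => ((Real.log x * x : ℝ) : ℂ)) (𝓝[>] 0) (𝓝 ((0 : ℝ) : ℂ)) := by
    refine (continuous_ofReal.tendsto 0).comp ?_
    simpa using tendsto_log_mul_rpow_nhdsGT_zero zero_lt_one
  have h3 := h1.add (h2.mul (tendsto_powerSum_ofReal hlog.succ))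
  have e : regCoeff a b 0 0 + ((0 : ℝ) : ℂ) * logCoeff a b 0 (0 + 1) =
      2 * digamma 1 - digamma a - digamma b := by
    simp [regCoeff, logCoeff, poch_zero]
    ring
  rw [e] at h3
  refine h3.congr' ?_
  filter_upwards [Ioo_mem_nhdsGT one_pos] with x hx
  have hn : ‖(x : ℂ)‖ < 1 := by simpa [abs_of_pos hx.1] using hx.2
  have e1 := mul_powerSum_succ hlog hn
  have e2 : logCoeff a b 0 0 = -1 := by simp [logCoeff, poch_zero]
  rw [e2] at e1
  push_cast
  rw [ofReal_log hx.1.le]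
  linear_combination log (x : ℂ) * e1

theorem eulerIntegral_eq_expansion {a b : ℂ} (ha : 2 ≤ a.re) (hb : 2 ≤ b.re) {w : ℂ}
    (hw : ‖w‖ < 1) (hw' : w ∈ slitPlane) :
    eulerIntegral a b (1 - w) =
      powerSum (regCoeff a b 0) w + log w * powerSum (logCoeff a b 0) w := by
  have ha0 : 0 < a.re := by linarith
  have hb0 : 0 < b.re := by linarith
  have ha' := ne_neg_nat_of_re_pos ha0
  have hb' := ne_neg_nat_of_re_pos hb0
  have hab' := ne_neg_nat_of_re_pos (show 0 < (a + b).re by simp; linarith)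
  have hP : PolyGrowth (regCoeff a b 0) :=
    polyGrowth_regCoeff 0 (by simpa using ha') (by simpa using hb')
  have hq := polyGrowth_gaussCoeff a b 1
  have hd := polyGrowth_gaussCoeff a b (a + b)
  have hQ : ∀ w, powerSum (logCoeff a b 0) w = -powerSum (gaussCoeff a b 1) w := by
    intro w
    have : logCoeff a b 0 = fun n => -1 * gaussCoeff a b 1 n := by
      ext n
      rw [logCoeff_zero_eq]
      ring
    rw [this, powerSum_const_mul]
    ring
  set B := Gamma a * Gamma b / Gamma (a + b) with hB
  let y : ℂ → ℂ := fun w => B * powerSum (gaussCoeff a b (a + b)) (1 - w) -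
    (powerSum (regCoeff a b 0) w - log w * powerSum (gaussCoeff a b 1) w)
  let y₁ : ℂ → ℂ := fun w => -B * powerSum (derivCoeff (gaussCoeff a b (a + b))) (1 - w) -
    (powerSum (derivCoeff (regCoeff a b 0)) w - (w⁻¹ * powerSum (gaussCoeff a b 1) w +
      log w * powerSum (derivCoeff (gaussCoeff a b 1)) w))
  let y₂ : ℂ → ℂ := fun w => B * powerSum (derivCoeff (derivCoeff (gaussCoeff a b (a + b)))) (1 - w) -
    (powerSum (derivCoeff (derivCoeff (regCoeff a b 0))) w -
      (-(w ^ 2)⁻¹ * powerSum (gaussCoeff a b 1) w +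
        2 * w⁻¹ * powerSum (derivCoeff (gaussCoeff a b 1)) w +
        log w * powerSum (derivCoeff (derivCoeff (gaussCoeff a b 1))) w))
  have hcomp : ∀ {u : ℕ → ℂ}, PolyGrowth u → ∀ w ∈ lens,
      HasDerivAt (fun w => powerSum u (1 - w)) (powerSum (derivCoeff u) (1 - w) * -1) w :=
    fun hu w hl => (hu.hasDerivAt (norm_one_sub_lt_one_of_mem_lens hl)).comp w
      ((hasDerivAt_id w).const_sub 1)
  have h1 : ∀ w ∈ lens, HasDerivAt y (y₁ w) w := by
    intro w hl
    have hn := norm_lt_one_of_mem_lens hl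
    have hs := mem_slitPlane_of_mem_lens hl
    refine (((hcomp hd w hl).const_mul B).sub ((hP.hasDerivAt hn).sub
      ((hasDerivAt_log hs).mul (hq.hasDerivAt hn)))).congr_deriv ?_
    simp only [y₁]
    ring
  have h2 : ∀ w ∈ lens, HasDerivAt y₁ (y₂ w) w := by
    intro w hl
    have hn := norm_lt_one_of_mem_lens hl
    have hs := mem_slitPlane_of_mem_lens hl
    refine (((hcomp hd.derivCoeff w hl).const_mul (-B)).sub ((hP.derivCoeff.hasDerivAt hn).sub
      (((hasDerivAt_inv (slitPlane_ne_zero hs)).mul (hq.hasDerivAt hn)).add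
        ((hasDerivAt_log hs).mul (hq.derivCoeff.hasDerivAt hn))))).congr_deriv ?_
    simp only [y₂]
    ring
  have hode : ∀ w ∈ lens,
      w * (1 - w) * y₂ w + (1 - (a + b + 1) * w) * y₁ w - a * b * y w = 0 := by
    intro w hl
    have hn := norm_lt_one_of_mem_lens hl
    have hw0 := slitPlane_ne_zero (mem_slitPlane_of_mem_lens hl)
    have e1 := gaussCoeff_one_ode a b hn
    have e2 := regCoeff_zero_ode ha' hb' hn
    -- The substitution z = 1 - w turns the equation with c = a + b into the one with a + b + 1 - c
    -- = 1.
    have e3 := powerSum_hypergeometric hd a b (a + b) (norm_one_sub_lt_one_of_mem_lens hl)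
    have e4 : powerSum (fun n => (n + 1) * (n + (a + b)) * gaussCoeff a b (a + b) (n + 1) -
        (n + a) * (n + b) * gaussCoeff a b (a + b) n) (1 - w) = 0 := by
      rw [powerSum]
      refine (tsum_congr fun n => ?_).trans tsum_zero
      have := gaussCoeff_succ a b (a + b) n hab'
      linear_combination (1 - w) ^ n * this
    rw [e4] at e3
    have i1 : w * w⁻¹ = 1 := mul_inv_cancel₀ hw0
    have i2 : w * (w ^ 2)⁻¹ = w⁻¹ := by field_simp
    simp only [y, y₁, y₂]
    -- Applied to log w · φ, the operator leaves 2(1-w)φ' - (a+b)φ besides log w times its value on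
    -- φ; `e2` cancels exactly this.
    linear_combination B * e3 - e2 + log w * e1 - (1 - w) * powerSum (gaussCoeff a b 1) w * i2 +
      (2 * (1 - w) * powerSum (derivCoeff (gaussCoeff a b 1)) w -
        (a + b) * powerSum (gaussCoeff a b 1) w) * i1
  have hlim : Tendsto (fun x : ℝ => y x) (𝓝[>] 0) (𝓝 0) := by
    have := (tendsto_eulerIntegral_add_log ha hb).sub (tendsto_expansion_sub_log ha' hb')
    rw [sub_self] at this
    refine this.congr' ?_
    filter_upwards [Ioo_mem_nhdsGT one_pos] with x hx
    have hl := ofReal_mem_lens hx.1 hx.2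
    simp only [y]
    rw [eulerIntegral_eq_powerSum ha0 hb0 (norm_one_sub_lt_one_of_mem_lens hl), hQ, hB]
    ring
  obtain ⟨δ, hδ0, hδ1, hzero⟩ := eventually_eq_zero_of_ode h1 h2 hode hlim
  have hopen : IsOpen (Metric.ball (0 : ℂ) 1 ∩ slitPlane) :=
    Metric.isOpen_ball.inter isOpen_slitPlane
  have hmem2 : ((δ / 2 : ℝ) : ℂ) ∈ Metric.ball (0 : ℂ) 1 ∩ slitPlane := by
    have hl := ofReal_mem_lens (x := δ / 2) (by positivity) (by linarith)
    exact ⟨hl.1, mem_slitPlane_of_mem_lens hl⟩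
  have hconn : IsPreconnected (Metric.ball (0 : ℂ) 1 ∩ slitPlane) := by
    have h1 : StarConvex ℝ ((δ / 2 : ℝ) : ℂ) (Metric.ball (0 : ℂ) 1) :=
      (convex_ball _ _).starConvex hmem2.1
    exact ((h1.inter (starConvex_ofReal_slitPlane (by positivity))).isPathConnected
      hmem2).isConnected.isPreconnected
  have hf : AnalyticOnNhd ℂ (fun w => eulerIntegral a b (1 - w))
      (Metric.ball (0 : ℂ) 1 ∩ slitPlane) := by
    refine DifferentiableOn.analyticOnNhd (fun w hw => ?_) hopen
    have hm := one_sub_mem_cutPlane hw.2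
    exact (((differentiableOn_eulerIntegral ha0 hb0).differentiableAt
      (isOpen_cutPlane.mem_nhds hm)).comp w (by fun_prop)).differentiableWithinAt
  have hg : AnalyticOnNhd ℂ
      (fun w => powerSum (regCoeff a b 0) w + log w * powerSum (logCoeff a b 0) w)
      (Metric.ball (0 : ℂ) 1 ∩ slitPlane) := by
    refine DifferentiableOn.analyticOnNhd (fun w hw => ?_) hopen
    have hn : ‖w‖ < 1 := by simpa using hw.1
    exact ((hP.hasDerivAt hn).add ((hasDerivAt_log hw.2).mul
      ((polyGrowth_logCoeff a b 0).hasDerivAt hn))).differentiableAt.differentiableWithinAt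
  -- Agreement on the real interval (0, δ), which accumulates at δ/2, propagates to the slit disc.
  refine hf.eqOn_of_preconnected_of_frequently_eq hg hconn hmem2 ?_ ⟨by simpa using hw, hw'⟩
  have htend : Tendsto (fun x : ℝ => (x : ℂ)) (𝓝[≠] (δ / 2)) (𝓝[≠] ((δ / 2 : ℝ) : ℂ)) := by
    refine tendsto_nhdsWithin_iff.2 ⟨(continuous_ofReal.tendsto _).mono_left nhdsWithin_le_nhds, ?_⟩
    filter_upwards [self_mem_nhdsWithin] with x hx
    exact fun h => hx (ofReal_injective h)
  refine htend.frequently (Eventually.frequently ?_)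
  filter_upwards [mem_nhdsWithin_of_mem_nhds
    (Ioo_mem_nhds (show 0 < δ / 2 by positivity) (show δ / 2 < δ by linarith))] with x hx
  have hl := ofReal_mem_lens hx.1 (hx.2.trans hδ1)
  have h0 := hzero x hx
  simp only [y] at h0
  rw [eulerIntegral_eq_powerSum ha0 hb0 (norm_one_sub_lt_one_of_mem_lens hl), hQ, ← hB]
  linear_combination h0

theorem hasLogExpansion_of_two_le_re {a b : ℂ} (ha : 2 ≤ a.re) (hb : 2 ≤ b.re) :
    HasLogExpansion a b 0 := by
  have ha0 : 0 < a.re := by linarith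
  have hb0 : 0 < b.re := by linarith
  refine ⟨_, by simpa using isGaussPrincipalBranch_eulerIntegral ha0 hb0, fun w hw hw' => ?_⟩
  rw [← eulerIntegral_eq_expansion ha hb hw hw']
  have h1 := Gamma_ne_zero_of_re_pos ha0
  have h2 := Gamma_ne_zero_of_re_pos hb0
  have h3 := Gamma_ne_zero_of_re_pos (show 0 < (a + b).re by simp; linarith)
  simp only [Nat.cast_zero, add_zero]
  field_simp

end

/-! ### Rewriting the expansion in its final form -/

/-- This holds also at the poles of Γ, where the inverse is 0 by convention. It therefore covers
parameters a, b that are nonpositive integers. -/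
theorem inv_Gamma_eq_poch_mul (a : ℂ) (m : ℕ) :
    (Complex.Gamma a)⁻¹ = poch a m * (Complex.Gamma (a + m))⁻¹ := by
  induction m with
  | zero => simp [poch_zero]
  | succ m ih =>
    rw [ih, Complex.one_div_Gamma_eq_self_mul_one_div_Gamma_add_one (a + m), poch_succ]
    push_cast
    ring_nf

/-- The terms of the logarithmic series at `w = 1 - z = 0`. -/
noncomputable def logTerm (a b : ℂ) (m : ℕ) (w : ℂ) (k : ℕ) : ℂ :=
  gaussCoeff (b + m) (a + m) (m + 1) k * w ^ k *
    (Complex.log w - Complex.digamma (k + m + 1) + Complex.digamma (k + a + m) +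
      Complex.digamma (k + b + m) - Complex.digamma (k + 1))

theorem summable_logTerm {a b : ℂ} {m : ℕ} (ha : ∀ n : ℕ, a + m ≠ -n) (hb : ∀ n : ℕ, b + m ≠ -n)
    {w : ℂ} (hw : ‖w‖ < 1) : Summable (logTerm a b m w) := by
  have hm : ∀ n : ℕ, ((m : ℂ) + 1) ≠ -n := ne_neg_nat_of_re_pos (by simp; positivity)
  have h := (polyGrowth_gaussCoeff (b + m) (a + m) (m + 1)).mul
    (((((PolyGrowth.const (Complex.log w)).sub (.digamma hm)).add (.digamma ha)).add
      (.digamma hb)).sub polyGrowth_digamma_nat)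
  convert h.summable hw using 2 with k
  rw [logTerm, show (k : ℂ) + m + 1 = m + 1 + k by ring, show (k : ℂ) + a + m = a + m + k by ring,
    show (k : ℂ) + b + m = b + m + k by ring]
  ring

theorem coeff_add_eq_logTerm (a b : ℂ) (m : ℕ) (w : ℂ) (k : ℕ) :
    (regCoeff a b m (k + m) + Complex.log w * logCoeff a b m (k + m)) * w ^ (k + m) =
      -(-w) ^ m * (poch a m * poch b m / m.factorial) * logTerm a b m w k := by
  have hf : (poch (m + 1) k : ℂ) * m.factorial = (k + m).factorial := by
    rw [← poch_one, ← poch_one, add_comm k, poch_add, add_comm (m : ℂ)]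
    ring
  have h0 := factorial_cast_ne_zero m
  have h1 := factorial_cast_ne_zero k
  have h2 : poch ((m : ℂ) + 1) k ≠ 0 :=
    poch_ne_zero (ne_neg_nat_of_re_pos (by simp; positivity)) k
  simp only [regCoeff, logCoeff, if_neg (show ¬ k + m < m by omega), Nat.add_sub_cancel, logTerm,
    gaussCoeff]
  rw [← hf, add_comm k m, poch_add, poch_add, pow_add, neg_pow w]
  push_cast
  rw [show (m : ℂ) + k + 1 = k + m + 1 by ring, show a + ((m : ℂ) + k) = k + a + m by ring,
    show b + ((m : ℂ) + k) = k + b + m by ring]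
  field_simp
  ring

/-- Splitting P + log w · Q at index m separates the finite sum from the logarithmic series. -/
theorem gaussF_one_sub_eq {a b : ℂ} {m : ℕ} (ha : ∀ n : ℕ, a + m ≠ -n)
    (hb : ∀ n : ℕ, b + m ≠ -n) (hc : ∀ n : ℕ, a + b + m ≠ -n) :
    IsGaussPrincipalBranch a b (a + b + m) (gaussF a b (a + b + m)) ∧
      ∀ w : ℂ, ‖w‖ < 1 → w ∈ Complex.slitPlane → gaussF a b (a + b + m) (1 - w) =
        Complex.Gamma (a + b + m) / (Complex.Gamma (a + m) * Complex.Gamma (b + m)) *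
            (∑ k ∈ Finset.range m,
              poch a k * poch b k * ((m - k - 1).factorial : ℂ) / (k.factorial : ℂ) * (-w) ^ k) -
          (-w) ^ m * (Complex.Gamma (a + b + m) /
            (Complex.Gamma b * Complex.Gamma a * (m.factorial : ℂ))) * ∑' k, logTerm a b m w k := by
  obtain ⟨F, hF, hexp⟩ := hasLogExpansion_of_base
    (fun _ _ h1 h2 => hasLogExpansion_of_two_le_re h1 h2) a b m ha hb hc
  refine ⟨hF.gaussF, fun w hw hw' => ?_⟩
  rw [hF.gaussF.eqOn hF (one_sub_mem_cutPlane hw')]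
  have hP := polyGrowth_regCoeff m ha hb
  have hQ := polyGrowth_logCoeff a b m
  have hPQ := hP.add (hQ.const_mul (Complex.log w))
  have e := hexp w hw hw'
  rw [← powerSum_const_mul, ← powerSum_add hP (hQ.const_mul _) hw, powerSum,
    ← (hPQ.summable hw).sum_add_tsum_nat_add m,
    tsum_congr (coeff_add_eq_logTerm a b m w), tsum_mul_left] at e
  have hsum : ∑ k ∈ Finset.range m,
      (regCoeff a b m k + Complex.log w * logCoeff a b m k) * w ^ k =
      ∑ k ∈ Finset.range m,
        poch a k * poch b k * ((m - k - 1).factorial : ℂ) / (k.factorial : ℂ) * (-w) ^ k := by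
    refine Finset.sum_congr rfl fun k hk => ?_
    have hk := Finset.mem_range.1 hk
    simp only [regCoeff, logCoeff, if_pos hk]
    rw [neg_pow w]
    ring
  rw [hsum] at e
  have hG : Complex.Gamma (a + b + m) / (Complex.Gamma b * Complex.Gamma a * (m.factorial : ℂ)) =
      Complex.Gamma (a + b + m) / (Complex.Gamma (a + m) * Complex.Gamma (b + m)) *
        (poch a m * poch b m / m.factorial) := by
    simp only [div_eq_mul_inv, mul_inv]
    rw [inv_Gamma_eq_poch_mul a m, inv_Gamma_eq_poch_mul b m]
    ring
  have h1 := Complex.Gamma_ne_zero ha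
  have h2 := Complex.Gamma_ne_zero hb
  have h3 := Complex.Gamma_ne_zero hc
  have hF' : F (1 - w) = Complex.Gamma (a + b + m) / (Complex.Gamma (a + m) * Complex.Gamma (b + m)) *
      (Complex.Gamma (a + m) * Complex.Gamma (b + m) / Complex.Gamma (a + b + m) * F (1 - w)) := by
    field_simp
  rw [hF', e, hG]
  ring

theorem mem_slitPlane_of_abs_arg_lt {w : ℂ} (h0 : w ≠ 0) (h : |Complex.arg w| < Real.pi) :
    w ∈ Complex.slitPlane :=
  Complex.mem_slitPlane_iff_arg.2 ⟨((le_abs_self _).trans_lt h).ne, h0⟩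

theorem mainTheorem7 :
    (∀ (μ ν ρ : ℂ) (m : ℕ), 0 < m → ρ - ν = (m : ℂ) →
      0 < ν.re → 0 < ρ.re → (∀ n : ℤ, ρ ≠ (n : ℂ)) → 0 < (ρ - ν + μ).re →
      IsGaussPrincipalBranch μ ν (μ + ρ) (gaussF μ ν (μ + ρ)) ∧
      ∀ z : ℂ, ‖z‖ < 1 → z ≠ 0 → |Complex.arg z| < Real.pi →
        Summable (fun k : ℕ =>
          poch ρ k * poch (μ + ρ - ν) k / (poch (ρ - ν + 1) k * (k.factorial : ℂ)) *
            (Complex.log z - Complex.digamma (k + ρ - ν + 1) + Complex.digamma (k + ρ - ν + μ)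
              + Complex.digamma (k + ρ) - Complex.digamma (k + 1)) * z ^ k) ∧
        gaussF μ ν (μ + ρ) (1 - z) =
          (-1) ^ (m + 1) *
              (Complex.Gamma (μ + ρ) /
                (Complex.Gamma μ * Complex.Gamma ν * Complex.Gamma (ρ - ν + 1))) * z ^ m *
            (∑' k : ℕ,
              poch ρ k * poch (μ + ρ - ν) k / (poch (ρ - ν + 1) k * (k.factorial : ℂ)) *
                (Complex.log z - Complex.digamma (k + ρ - ν + 1) + Complex.digamma (k + ρ - ν + μ)
                  + Complex.digamma (k + ρ) - Complex.digamma (k + 1)) * z ^ k) +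
          Complex.Gamma (μ + ρ) / (Complex.Gamma ρ * Complex.Gamma (μ + ρ - ν)) *
            ∑ k ∈ Finset.range m,
              (-1) ^ k * (poch μ k * poch ν k * ((m - k - 1).factorial : ℂ) /
                (k.factorial : ℂ)) * z ^ k) ∧
    (∀ (μ ν : ℂ) (m : ℕ), 0 < m →
      (∀ n : ℕ, μ + m ≠ -(n : ℂ)) → (∀ n : ℕ, ν + m ≠ -(n : ℂ)) →
      (∀ n : ℕ, μ + ν + m ≠ -(n : ℂ)) →
      IsGaussPrincipalBranch μ ν (μ + ν + m) (gaussF μ ν (μ + ν + m)) ∧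
      ∀ z : ℂ, ‖1 - z‖ < 1 → z ≠ 1 → |Complex.arg (1 - z)| < Real.pi →
        Summable (fun k : ℕ =>
          poch (ν + m) k * poch (μ + m) k / (poch (m + 1) k * (k.factorial : ℂ)) *
            (1 - z) ^ k *
            (Complex.log (1 - z) - Complex.digamma (k + m + 1) + Complex.digamma (k + μ + m)
              + Complex.digamma (k + ν + m) - Complex.digamma (k + 1))) ∧
        gaussF μ ν (μ + ν + m) z =
          Complex.Gamma (μ + ν + m) / (Complex.Gamma (μ + m) * Complex.Gamma (ν + m)) *
            (∑ k ∈ Finset.range m,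
              poch μ k * poch ν k * ((m - k - 1).factorial : ℂ) / (k.factorial : ℂ) *
                (z - 1) ^ k) -
          (z - 1) ^ m *
              (Complex.Gamma (μ + ν + m) /
                (Complex.Gamma ν * Complex.Gamma μ * (m.factorial : ℂ))) *
            ∑' k : ℕ,
              poch (ν + m) k * poch (μ + m) k / (poch (m + 1) k * (k.factorial : ℂ)) *
                (1 - z) ^ k *
                (Complex.log (1 - z) - Complex.digamma (k + m + 1) + Complex.digamma (k + μ + m)
                  + Complex.digamma (k + ν + m) - Complex.digamma (k + 1))) := by
  constructor
  · intro μ ν ρ m _ hρν hν hρ _ hμ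
    obtain rfl : ρ = ν + m := by linear_combination hρν
    have hre : 0 < (μ + m).re := by
      rwa [hρν, add_comm] at hμ
    -- Positive real parts exclude all poles; for the third parameter, Re(μ+ν+m) = Re(μ+m) + Re ν.
    obtain ⟨hbranch, hexp⟩ := gaussF_one_sub_eq (m := m) (ne_neg_nat_of_re_pos hre)
      (ne_neg_nat_of_re_pos hρ) (ne_neg_nat_of_re_pos (a := μ + ν + m) (by
        rw [add_right_comm, Complex.add_re]
        exact add_pos hre hν))
    have ec : μ + (ν + m) = μ + ν + m := by ring
    refine ⟨by rw [ec]; exact hbranch, fun z hz hz0 harg => ?_⟩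
    have hterm : (fun k : ℕ =>
        poch (ν + m) k * poch (μ + (ν + m) - ν) k / (poch (ν + m - ν + 1) k * (k.factorial : ℂ)) *
          (Complex.log z - Complex.digamma (k + (ν + m) - ν + 1) +
            Complex.digamma (k + (ν + m) - ν + μ) + Complex.digamma (k + (ν + m)) -
            Complex.digamma (k + 1)) * z ^ k) = logTerm μ ν m z := by
      ext k
      rw [show μ + (ν + m) - ν = μ + m by ring, show ν + m - ν + 1 = (m : ℂ) + 1 by ring,
        show (k : ℂ) + (ν + m) - ν + 1 = k + m + 1 by ring,
        show (k : ℂ) + (ν + m) - ν + μ = k + μ + m by ring,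
        show (k : ℂ) + (ν + m) = k + ν + m by ring, logTerm, gaussCoeff]
      ring
    rw [hterm]
    refine ⟨summable_logTerm (ne_neg_nat_of_re_pos hre) (ne_neg_nat_of_re_pos hρ) hz, ?_⟩
    rw [ec, hexp z hz (mem_slitPlane_of_abs_arg_lt hz0 harg),
      show μ + ν + m - ν = μ + m by ring, show ν + m - ν + 1 = (m : ℂ) + 1 by ring,
      Complex.Gamma_nat_eq_factorial, mul_comm (Complex.Gamma (ν + m)),
      mul_comm (Complex.Gamma μ)]
    have hsum : ∑ k ∈ Finset.range m,
        poch μ k * poch ν k * ((m - k - 1).factorial : ℂ) / (k.factorial : ℂ) * (-z) ^ k =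
        ∑ k ∈ Finset.range m, (-1) ^ k * (poch μ k * poch ν k * ((m - k - 1).factorial : ℂ) /
          (k.factorial : ℂ)) * z ^ k := by
      refine Finset.sum_congr rfl fun k _ => ?_
      rw [neg_pow z]
      ring
    -- The sign (-1)^m from (-z)^m and the minus before the series combine to (-1)^(m+1), which is
    -- (-1)^(ν-ρ+1).
    rw [hsum, neg_pow z]
    ring
  · intro μ ν m _ hμ hν hc
    obtain ⟨hbranch, hexp⟩ := gaussF_one_sub_eq hμ hν hc
    refine ⟨hbranch, fun z hz hz1 harg => ?_⟩
    refine ⟨summable_logTerm hμ hν hz, ?_⟩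
    have := hexp (1 - z) hz (mem_slitPlane_of_abs_arg_lt (sub_ne_zero.2 hz1.symm) harg)
    rw [sub_sub_cancel, neg_sub] at this
    exact this
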